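/- Let $d\ge 2$ be an integer and for each integer $k\ge 2$ let $\mathbb{T}_{d,k}$ be the oriented graph whose vertices are all finite words over $\{1,\dots,d\}$ (the empty word is the root $o$), with "short" edges $\langle r, r\cdot i\rangle$ for every vertex $r$ and $i\in\{1,\dots,d\}$, and "long" edges $\langle r, r\cdot w\rangle$ for every vertex $r$ and every word $w\in\{1,\dots,d\}^k$, where $\cdot$ is concatenation. Let every short edge be open with probability $p\in[0,1]$ and every long edge be open with probability $q\in[0,1]$, all independently; let $\mathscr{C}_{p,q}$ be the set of vertices that can be reached from $o$ by an oriented open path, and let $$q_c(k) = q_c(k,p,d) := \inf\{q\in[0,1] : \mathbb{P}(|\mathscr{C}_{p,q}|=\infty)>0\}.$$ Then, for every fixed $d$ and $p$ with $pd<1$, as $k\to\infty$, $$q_c(k) = (1-pd)\cdot\frac{1}{d^k} + \frac{(1-pd)^2p^2d}{1-p^2d}\cdot\frac{1}{d^{2k}} + o\left(\frac{1}{d^{2k}}\right).$$ -/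

import Mathlib

open MeasureTheory Filter Asymptotics

namespace TreePercolation

/-- Vertices: finite words over the alphabet `[d]`; the empty word is the root. -/
abbrev Vertex (d : ℕ) : Type := List (Fin d)

/-- Oriented edges of the graph. `short r i` goes from `r` to its child `r · i`, and `long r w` goes
from `r` to its descendant `r · w` at distance `k`. -/
inductive Edge (d k : ℕ) : Type
  | short (r : Vertex d) (i : Fin d) : Edge d k
  | long (r : Vertex d) (w : Fin k → Fin d) : Edge d k

namespace Edge

/-- The vertex an edge starts from. -/
def source {d k : ℕ} : Edge d k → Vertex d
  | short r _ => r
  | long r _ => r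

/-- The vertex an edge points to. -/
def target {d k : ℕ} : Edge d k → Vertex d
  | short r i => r ++ [i]
  | long r w => r ++ List.ofFn w

/-- The probability that an edge is open: `p` for short edges and `q` for long edges. -/
def openProb {d k : ℕ} (p q : unitInterval) : Edge d k → unitInterval
  | short _ _ => p
  | long _ _ => q

end Edge

/-- A configuration says of every edge whether it is open (`true`) or closed (`false`). -/
abbrev Config (d k : ℕ) : Type := Edge d k → Bool

/-- The law of the percolation model: the edges are open independently, short edges with
probability `p` and long edges with probability `q`. -/
noncomputable def law (d k : ℕ) (p q : unitInterval) : Measure (Config d k) :=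
  Measure.infinitePi fun e : Edge d k =>
    ProbabilityTheory.bernoulliMeasure true false (e.openProb p q)

/-- There is an open edge from `u` to `v`. -/
def OpenStep {d k : ℕ} (ω : Config d k) (u v : Vertex d) : Prop :=
  ∃ e : Edge d k, ω e = true ∧ e.source = u ∧ e.target = v

/-- The cluster of the root: the vertices that can be reached from the root by an oriented
open path. -/
def cluster {d k : ℕ} (ω : Config d k) : Set (Vertex d) :=
  {v | Relation.ReflTransGen (OpenStep ω) [] v}

/-- The critical value `q_c(k)`, for fixed `d` and `p`: the infimum of the `q ∈ [0, 1]` for which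
the cluster of the root is infinite with positive probability. -/
noncomputable def qc (d k : ℕ) (p : unitInterval) : ℝ :=
  sInf {x : ℝ | ∃ q : unitInterval, (q : ℝ) = x ∧
    0 < law d k p q {ω | (cluster ω).Infinite}}

end TreePercolation

/-!
The vertex `r · i` has exactly one short edge into it and, if it lies deep enough, exactly one long
edge. So whether it is in the cluster is decided by two independent coins together with the
*history* of `r`, the record of which ancestors of `r` are in the cluster. Down the tree, histories
form a branching chain: given its own history, a vertex has `d` children whose histories are
independent and identically distributed. The cluster is infinite iff every generation has a vertex
whose last `k` history entries are not all zero (`cluster_infinite_iff`), and the probability that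
generation `n` has one is given by an explicit recursion, `survival` (`law_real_reaches`).

Such a chain survives, or dies out, as soon as there is a weight `h` on histories whose total over
the children exceeds (`survival_bounded_below`), or falls short of (`survival_tendsto_zero`), that
of the parent on average. If vertices were counted with multiplicity, a linear weight would do, and
the critical value would be `(1 - p d) / d ^ k`. The second order term comes from vertices whose
short and long edges are both open while both starting points are in the cluster. The main
contribution is from `m` short steps before a long edge against `m` short steps after one, and
summing over `m` gives the geometric series `∑ (p ^ 2 d) ^ m`. The weight used here is a linear one
minus `p q` times the expected weighted number of such collisions that the history has in store
(`collisionWeight`), a quadratic form for which the drift can be computed exactly (`weight_drift`).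
The remaining error terms are of lower order and are absorbed into the coefficients of the linear
part. This gives explicit inequalities in `q` for survival and for extinction
(`survival_criterion`, `extinction_criterion`), which agree up to `o(d ^ (-2 k))`.
-/

namespace TreePercolation

/-! ### The history chain and the survival recursion -/

/-- A history `x : ℕ → Bool` records which ancestors of a vertex lie in the cluster: `x 0` is the
vertex itself and `x j` its ancestor `j` generations back. `push b x` is the history of a child
that lies in the cluster iff `b = true`. -/
def push (b : Bool) (x : ℕ → Bool) : ℕ → Bool
  | 0 => b
  | j + 1 => x j

/-- The history of the root: nothing precedes it. -/
def rootHistory : ℕ → Bool := push true fun _ => false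

/-- The entries of a history as real numbers `0` and `1`. -/
def bit (x : ℕ → Bool) (j : ℕ) : ℝ := if x j = true then 1 else 0

/-- The number of the latest `k` generations that are in the cluster. -/
noncomputable def load (k : ℕ) (x : ℕ → Bool) : ℝ := ∑ j ∈ Finset.range k, bit x j

/-- A history is alive if one of its latest `k` entries is active; only such a history can have
active descendants. -/
def Alive (k : ℕ) (x : ℕ → Bool) : Prop := ∃ j < k, x j = true

/-- The probability that a child of a vertex with history `x` is active: its short edge starts at
the vertex itself, its long edge at the ancestor `k - 1` generations back. -/
noncomputable def birthProb (k : ℕ) (p q : ℝ) (x : ℕ → Bool) : ℝ :=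
  1 - (1 - p * bit x 0) * (1 - q * bit x (k - 1))

/-- The expectation of `f` at the history of a child, given the history `x` of the parent. -/
noncomputable def childMean (k : ℕ) (p q : ℝ) (f : (ℕ → Bool) → ℝ) (x : ℕ → Bool) : ℝ :=
  birthProb k p q x * f (push true x) + (1 - birthProb k p q x) * f (push false x)

open Classical in
/-- The probability that a vertex with history `x` has a descendant `n` generations below whose
history is alive. -/
noncomputable def survival (d k : ℕ) (p q : ℝ) : ℕ → (ℕ → Bool) → ℝ
  | 0, x => if Alive k x then 1 else 0
  | n + 1, x => 1 - (1 - childMean k p q (survival d k p q n) x) ^ d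

lemma bit_nonneg (x : ℕ → Bool) (j : ℕ) : 0 ≤ bit x j := by
  unfold bit; split_ifs <;> norm_num

lemma bit_le_one (x : ℕ → Bool) (j : ℕ) : bit x j ≤ 1 := by
  unfold bit; split_ifs <;> norm_num

lemma bit_eq_zero_or_one (x : ℕ → Bool) (j : ℕ) : bit x j = 0 ∨ bit x j = 1 := by
  unfold bit; split_ifs <;> simp

lemma load_nonneg (k : ℕ) (x : ℕ → Bool) : 0 ≤ load k x :=
  Finset.sum_nonneg fun _ _ => bit_nonneg _ _

lemma load_le (k : ℕ) (x : ℕ → Bool) : load k x ≤ k := by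
  unfold load
  calc _ ≤ ∑ j ∈ Finset.range k, (1 : ℝ) := Finset.sum_le_sum fun _ _ => bit_le_one _ _
    _ = k := by simp

lemma one_le_load {k : ℕ} {x : ℕ → Bool} (h : Alive k x) : 1 ≤ load k x := by
  obtain ⟨j, hj, hx⟩ := h
  have : bit x j = 1 := by simp [bit, hx]
  rw [← this]
  exact Finset.single_le_sum (fun i _ => bit_nonneg x i) (Finset.mem_range.2 hj)

lemma load_eq_zero {k : ℕ} {x : ℕ → Bool} (h : ¬ Alive k x) : load k x = 0 := by
  refine Finset.sum_eq_zero fun j hj => ?_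
  have : ¬ x j = true := fun hx => h ⟨j, Finset.mem_range.1 hj, hx⟩
  simp [bit, this]

section Bounds

variable {d k : ℕ} {p q : ℝ}

lemma birthProb_nonneg (hp0 : 0 ≤ p) (hq0 : 0 ≤ q) (hq1 : q ≤ 1) (x : ℕ → Bool) :
    0 ≤ birthProb k p q x := by
  unfold birthProb
  rcases bit_eq_zero_or_one x 0 with h | h <;> rcases bit_eq_zero_or_one x (k - 1) with h' | h' <;>
    rw [h, h'] <;> nlinarith

lemma birthProb_le_one (hp1 : p ≤ 1) (hq1 : q ≤ 1) (x : ℕ → Bool) :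
    birthProb k p q x ≤ 1 := by
  unfold birthProb
  rcases bit_eq_zero_or_one x 0 with h | h <;> rcases bit_eq_zero_or_one x (k - 1) with h' | h' <;>
    rw [h, h'] <;> nlinarith

lemma childMean_mono (hp0 : 0 ≤ p) (hp1 : p ≤ 1) (hq0 : 0 ≤ q) (hq1 : q ≤ 1)
    {f g : (ℕ → Bool) → ℝ} (h : ∀ x, f x ≤ g x) (x : ℕ → Bool) :
    childMean k p q f x ≤ childMean k p q g x := by
  have h0 := birthProb_nonneg (k := k) hp0 hq0 hq1 x
  have h1 := birthProb_le_one (k := k) hp1 hq1 x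
  unfold childMean
  have := mul_le_mul_of_nonneg_left (h (push true x)) h0
  have := mul_le_mul_of_nonneg_left (h (push false x)) (sub_nonneg.2 h1)
  linarith

lemma childMean_const_mul (a : ℝ) (f : (ℕ → Bool) → ℝ) (x : ℕ → Bool) :
    childMean k p q (fun y => a * f y) x = a * childMean k p q f x := by
  unfold childMean; ring

lemma childMean_const (a : ℝ) (x : ℕ → Bool) : childMean k p q (fun _ => a) x = a := by
  unfold childMean; ring

lemma survival_mem_Icc (hp0 : 0 ≤ p) (hp1 : p ≤ 1) (hq0 : 0 ≤ q) (hq1 : q ≤ 1) (n : ℕ)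
    (x : ℕ → Bool) : survival d k p q n x ∈ Set.Icc (0 : ℝ) 1 := by
  induction n generalizing x with
  | zero => simp only [survival]; split_ifs <;> simp
  | succ n ih =>
    have h0 : 0 ≤ childMean k p q (survival d k p q n) x := by
      have := childMean_mono (k := k) hp0 hp1 hq0 hq1 (fun y => (ih y).1) x
      rwa [childMean_const] at this
    have h1 : childMean k p q (survival d k p q n) x ≤ 1 := by
      have := childMean_mono (k := k) hp0 hp1 hq0 hq1 (fun y => (ih y).2) x
      rwa [childMean_const] at this
    simp only [survival]
    refine ⟨sub_nonneg.2 (pow_le_one₀ (by linarith) (by linarith)), ?_⟩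
    have := pow_nonneg (sub_nonneg.2 h1) d
    linarith

/-- If the total weight `h` of the children exceeds on average that of the parent by a fixed
proportion, the branching chain survives: a small multiple of `h` is a lower bound that the
recursion for the survival probability reproduces. -/
lemma survival_bounded_below (hd : 1 ≤ d) (hp0 : 0 ≤ p) (hp1 : p ≤ 1) (hq0 : 0 ≤ q) (hq1 : q ≤ 1)
    {h : (ℕ → Bool) → ℝ} {ε M : ℝ} (hε : 0 < ε) (hM : ∀ x, h x ≤ M * load k x)
    (hdrift : ∀ x, h x + ε * load k x ≤ d * childMean k p q h x) (hroot : 0 < h rootHistory) :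
    ∃ σ > 0, ∀ n, σ ≤ survival d k p q n rootHistory := by
  obtain ⟨L, hL1, hL⟩ : ∃ L : ℝ, 1 ≤ L ∧ ∀ x, h x ≤ L * load k x :=
    ⟨max 1 M, le_max_left _ _, fun x => (hM x).trans
      (mul_le_mul_of_nonneg_right (le_max_right _ _) (load_nonneg _ _))⟩
  have hd' : (1 : ℝ) ≤ d := by exact_mod_cast hd
  set η : ℝ := ε / L with hη
  have hη0 : 0 < η := by positivity
  have hdr : ∀ x, (1 + η) * h x ≤ d * childMean k p q h x := by
    intro x
    have : η * h x ≤ ε * load k x := by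
      calc η * h x ≤ η * (L * load k x) := mul_le_mul_of_nonneg_left (hL x) hη0.le
        _ = ε * load k x := by rw [hη]; field_simp
    have := hdrift x
    linarith
  set δ : ℝ := min 1 η / ((1 + η) * (L * (k + 1))) with hδ
  have hk0 : (0 : ℝ) ≤ k := Nat.cast_nonneg k
  have hmin : 0 < min 1 η := lt_min one_pos hη0
  have hδ0 : 0 < δ := by positivity
  have hsmall : ∀ x, δ * (1 + η) * h x ≤ min 1 η := by
    intro x
    have h1 : h x ≤ L * (k + 1) := (hL x).trans (mul_le_mul_of_nonneg_left
      ((load_le k x).trans (by linarith)) (by linarith))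
    calc δ * (1 + η) * h x ≤ δ * (1 + η) * (L * (k + 1)) :=
          mul_le_mul_of_nonneg_left h1 (by positivity)
      _ = min 1 η := by rw [hδ]; field_simp
  have key : ∀ n x, δ * h x ≤ survival d k p q n x := by
    intro n
    induction n with
    | zero =>
      intro x
      simp only [survival]
      split_ifs with hx
      · rcases le_or_gt (h x) 0 with h0 | h0
        · nlinarith
        · have h1 := (hsmall x).trans (min_le_left _ _)
          nlinarith [mul_pos (mul_pos hδ0 hη0) h0]
      · have := hL x
        rw [load_eq_zero hx, mul_zero] at this
        nlinarith
    | succ n ih =>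
      intro x
      rcases le_or_gt (h x) 0 with h0 | h0
      · exact (mul_nonpos_of_nonneg_of_nonpos hδ0.le h0).trans
          (survival_mem_Icc hp0 hp1 hq0 hq1 _ _).1
      set m := childMean k p q (survival d k p q n) x with hm
      have hm1 : m ≤ 1 := by
        have := childMean_mono (k := k) hp0 hp1 hq0 hq1
          (fun y => (survival_mem_Icc (d := d) (k := k) hp0 hp1 hq0 hq1 n y).2) x
        rwa [childMean_const] at this
      have hmlow : δ * childMean k p q h x ≤ m := by
        rw [← childMean_const_mul]
        exact childMean_mono hp0 hp1 hq0 hq1 ih x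
      set s := δ * (1 + η) * h x with hs
      have hs0 : 0 < s := by positivity
      have hs1 : s ≤ 1 := (hsmall x).trans (min_le_left _ _)
      have hsη : s ≤ η := (hsmall x).trans (min_le_right _ _)
      set t := s / d with ht
      have hdt : (d : ℝ) * t = s := by rw [ht]; field_simp
      have ht0 : 0 < t := by positivity
      have ht1 : t ≤ 1 := by nlinarith
      have htm : t ≤ m := by
        refine le_trans ?_ hmlow
        have h2 := mul_le_mul_of_nonneg_left (hdr x) hδ0.le
        have h3 : (d : ℝ) * t ≤ d * (δ * childMean k p q h x) := by rw [hdt, hs]; linarith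
        exact le_of_mul_le_mul_left h3 (by linarith)
      have hpow : (1 - m) ^ d ≤ (1 - t) ^ d := pow_le_pow_left₀ (by linarith) (by linarith) d
      have hbern : 1 + s ≤ (1 + t) ^ d := by
        rw [← hdt]; exact one_add_mul_le_pow (by linarith) d
      have hprod : (1 - t) ^ d * (1 + s) ≤ 1 := by
        calc (1 - t) ^ d * (1 + s) ≤ (1 - t) ^ d * (1 + t) ^ d :=
              mul_le_mul_of_nonneg_left hbern (pow_nonneg (by linarith) d)
          _ = ((1 - t) * (1 + t)) ^ d := (mul_pow _ _ _).symm
          _ ≤ 1 := pow_le_one₀ (by nlinarith) (by nlinarith)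
      have hquot : (1 - t) ^ d ≤ 1 / (1 + s) := (le_div_iff₀ (by linarith)).2 hprod
      simp only [survival]
      have hfin : δ * h x ≤ 1 - 1 / (1 + s) := by
        have e1 : δ * h x = s / (1 + η) := by rw [hs]; field_simp
        have e2 : 1 - 1 / (1 + s) = s / (1 + s) := by field_simp; ring
        rw [e1, e2]
        exact div_le_div_of_nonneg_left hs0.le (by linarith) (by linarith)
      linarith
  exact ⟨δ * h rootHistory, by positivity, fun n => key n _⟩

/-- If the total weight `h` of the children falls on average short of that of the parent by a fixed
proportion, the branching chain dies out. -/
lemma survival_tendsto_zero (hp0 : 0 ≤ p) (hp1 : p ≤ 1) (hq0 : 0 ≤ q) (hq1 : q ≤ 1)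
    {h : (ℕ → Bool) → ℝ} {ε M m : ℝ} (hε : 0 < ε) (hm : 0 < m) (hlow : ∀ x, m * load k x ≤ h x)
    (hM : ∀ x, h x ≤ M * load k x)
    (hdrift : ∀ x, d * childMean k p q h x ≤ h x - ε * load k x) :
    Tendsto (fun n => survival d k p q n rootHistory) atTop (nhds 0) := by
  obtain ⟨L, hL1, hL⟩ : ∃ L : ℝ, ε < L ∧ ∀ x, h x ≤ L * load k x :=
    ⟨max (ε + 1) M, (lt_add_one ε).trans_le (le_max_left _ _), fun x => (hM x).trans
      (mul_le_mul_of_nonneg_right (le_max_right _ _) (load_nonneg _ _))⟩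
  set r : ℝ := 1 - ε / L with hr
  have hL0 : 0 < L := hε.trans hL1
  have hr0 : 0 ≤ r := by rw [hr, sub_nonneg, div_le_one hL0]; exact hL1.le
  have hr1 : r < 1 := by rw [hr]; have : 0 < ε / L := by positivity
                         linarith
  have hdr : ∀ x, d * childMean k p q h x ≤ r * h x := by
    intro x
    have : ε / L * h x ≤ ε * load k x := by
      calc ε / L * h x ≤ ε / L * (L * load k x) :=
            mul_le_mul_of_nonneg_left (hL x) (by positivity)
        _ = ε * load k x := by field_simp
    have := hdrift x
    rw [hr]; linarith
  have key : ∀ n x, survival d k p q n x ≤ r ^ n / m * h x := by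
    intro n
    induction n with
    | zero =>
      intro x
      simp only [survival]
      have h1 := hlow x
      have e : r ^ 0 / m * h x = h x / m := by rw [pow_zero]; ring
      rw [e]
      split_ifs with hx
      · rw [le_div_iff₀ hm]
        nlinarith [one_le_load hx]
      · exact div_nonneg (le_trans (mul_nonneg hm.le (load_nonneg _ _)) h1) hm.le
    | succ n ih =>
      intro x
      simp only [survival]
      set c := childMean k p q (survival d k p q n) x with hc
      have hc1 : c ≤ 1 := by
        have := childMean_mono (k := k) hp0 hp1 hq0 hq1
          (fun y => (survival_mem_Icc (d := d) (k := k) hp0 hp1 hq0 hq1 n y).2) x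
        rwa [childMean_const] at this
      have hcup : c ≤ r ^ n / m * childMean k p q h x := by
        rw [← childMean_const_mul]
        exact childMean_mono hp0 hp1 hq0 hq1 ih x
      have hbern : 1 + (d : ℝ) * (-c) ≤ (1 + -c) ^ d := one_add_mul_le_pow (by linarith) d
      rw [← sub_eq_add_neg] at hbern
      have hrn : 0 ≤ r ^ n / m := by positivity
      calc 1 - (1 - c) ^ d ≤ d * c := by linarith
        _ ≤ d * (r ^ n / m * childMean k p q h x) :=
            mul_le_mul_of_nonneg_left hcup (Nat.cast_nonneg d)
        _ = r ^ n / m * (d * childMean k p q h x) := by ring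
        _ ≤ r ^ n / m * (r * h x) := mul_le_mul_of_nonneg_left (hdr x) hrn
        _ = r ^ (n + 1) / m * h x := by ring
  refine squeeze_zero (fun n => (survival_mem_Icc hp0 hp1 hq0 hq1 n _).1) (fun n => key n _) ?_
  have := ((tendsto_pow_atTop_nhds_zero_of_lt_one hr0 hr1).div_const m).mul_const (h rootHistory)
  simpa using this

end Bounds

/-! ### The corrected weight and its drift -/

/-- The sum `∑ j < n, a ^ (n - 1 - j) * u j`, in Horner form. -/
def hornerSum (a : ℝ) : ℕ → (ℕ → ℝ) → ℝ
  | 0, _ => 0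
  | n + 1, u => a * hornerSum a n u + u n

/-- The sum `∑ j < n, a ^ j * u j`. -/
noncomputable def geomSum (a : ℝ) (n : ℕ) (u : ℕ → ℝ) : ℝ := ∑ j ∈ Finset.range n, a ^ j * u j

/-- The sum of `θ ^ i * (α * θ) ^ (j - i - 1) * u i * u j` over all pairs `i < j ≤ n`, grouped by
the larger index `j`. -/
noncomputable def pairSum (α θ : ℝ) (n : ℕ) (u : ℕ → ℝ) : ℝ :=
  ∑ j ∈ Finset.range n, u (j + 1) * (θ ^ j * hornerSum α (j + 1) u)

lemma hornerSum_succ_left (a : ℝ) (n : ℕ) (u : ℕ → ℝ) :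
    hornerSum a (n + 1) u = a ^ n * u 0 + hornerSum a n (fun j => u (j + 1)) := by
  induction n with
  | zero => simp [hornerSum]
  | succ n ih => rw [hornerSum, ih, hornerSum]; ring

lemma geomSum_succ_right (a : ℝ) (n : ℕ) (u : ℕ → ℝ) :
    geomSum a (n + 1) u = geomSum a n u + a ^ n * u n := Finset.sum_range_succ _ _

lemma geomSum_succ_left (a : ℝ) (n : ℕ) (u : ℕ → ℝ) :
    geomSum a (n + 1) u = u 0 + a * geomSum a n (fun j => u (j + 1)) := by
  unfold geomSum
  rw [Finset.sum_range_succ', Finset.mul_sum, pow_zero, one_mul, add_comm]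
  congr 1
  exact Finset.sum_congr rfl fun j _ => by ring

lemma pairSum_succ_right (α θ : ℝ) (n : ℕ) (u : ℕ → ℝ) :
    pairSum α θ (n + 1) u = pairSum α θ n u + u (n + 1) * (θ ^ n * hornerSum α (n + 1) u) :=
  Finset.sum_range_succ _ _

/-- Grouping the pairs by the smaller index instead: those with `i = 0` come first, the others form
the pair sum of the shifted sequence. -/
lemma pairSum_succ_left (α θ : ℝ) (n : ℕ) (u : ℕ → ℝ) :
    pairSum α θ (n + 1) u = u 0 * geomSum (α * θ) (n + 1) (fun j => u (j + 1)) +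
      θ * pairSum α θ n (fun j => u (j + 1)) := by
  induction n with
  | zero => simp [pairSum, geomSum, hornerSum]; ring
  | succ n ih =>
    rw [pairSum_succ_right, ih, hornerSum_succ_left, geomSum_succ_right _ (n + 1),
      pairSum_succ_right, mul_pow]
    ring

/-- The expected weighted number of collisions (two open edges into the same vertex) that the
present history has in store, for histories of length `K + 2`. Here `α = p d`, `θ = 1 / d`,
`Q = q d ^ (K + 2)` and `g = 1 / (1 - p ^ 2 d)`. The pairs with `i = 0` can still meet through the
short edges out of the present vertex, which accounts for their additional terms. -/
noncomputable def collisionWeight (d p Q g α θ : ℝ) (K : ℕ) (u : ℕ → ℝ) : ℝ :=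
  d * (u 0 * hornerSum α (K + 1) (fun j => u (j + 1))) +
    Q * ((g - 1) * (u 0 * geomSum p (K + 1) (fun j => u (j + 1))) + pairSum α θ (K + 1) u)

/-- The linear weight with coefficients `a`, corrected for collisions. -/
noncomputable def weight (a : ℕ → ℝ) (d p q Q g α θ : ℝ) (K : ℕ) (x : ℕ → Bool) : ℝ :=
  ∑ j ∈ Finset.range (K + 2), a j * bit x j - p * q * collisionWeight d p Q g α θ K (bit x)

lemma bit_push_succ (b : Bool) (x : ℕ → Bool) : (fun j => bit (push b x) (j + 1)) = bit x := rfl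

lemma bit_push_true (x : ℕ → Bool) : bit (push true x) 0 = 1 := by simp [bit, push]

lemma bit_push_false (x : ℕ → Bool) : bit (push false x) 0 = 0 := by simp [bit, push]

/-- The drift of the corrected weight. The linear part loses `d * p * q` for each pair of active
entries `0` and `K + 1`, because the two edges into a child may both be open; the
collision weight is made to cancel this loss, up to a multiple of `bit x 0` and lower order terms. -/
lemma weight_drift {d p q Q g α θ : ℝ} (a : ℕ → ℝ) (K : ℕ) (ha : a 0 = 1) (hα : α = p * d)
    (hθ : d * θ = 1) (hg : g * (1 - p ^ 2 * d) = 1) (hQ : Q * θ ^ (K + 2) = q) (x : ℕ → Bool) :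
    d * childMean (K + 2) p q (weight a d p q Q g α θ K) x - weight a d p q Q g α θ K x =
      (α + d * a 1 - 1 - p * q * (Q * α * g + d * α ^ (K + 1))) * bit x 0 +
      ∑ j ∈ Finset.range K, (d * a (j + 2) - a (j + 1)) * bit x (j + 1) +
      (d * q - a (K + 1)) * bit x (K + 1) +
      p * q * Q * (p * (bit x 0 * bit x (K + 1)) * (θ ^ K * hornerSum α (K + 1) (bit x)) +
        p ^ 2 * d * g * p ^ K * (bit x 0 * bit x (K + 1)) -
        d * q * g * ((1 - p * bit x 0) * bit x (K + 1)) *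
          (bit x 0 + p * geomSum p K (fun j => bit x (j + 1)))) := by
  have hp : p = α * θ := by rw [hα, mul_assoc, hθ, mul_one]
  have hQ' : d ^ 2 * q = Q * θ ^ K := by
    rw [← hQ]
    linear_combination (Q * θ ^ K * (d * θ + 1)) * hθ
  have hlin : ∀ b : Bool, ∑ j ∈ Finset.range (K + 2), a j * bit (push b x) j =
      ∑ j ∈ Finset.range (K + 1), a (j + 1) * bit x j + bit (push b x) 0 := by
    intro b
    rw [Finset.sum_range_succ', ha, one_mul]
    rfl
  have hlin1 : ∑ j ∈ Finset.range (K + 1), a (j + 1) * bit x j =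
      ∑ j ∈ Finset.range K, a (j + 2) * bit x (j + 1) + a 1 * bit x 0 := by
    rw [Finset.sum_range_succ']
  have hlin2 : ∑ j ∈ Finset.range (K + 2), a j * bit x j =
      ∑ j ∈ Finset.range K, a (j + 1) * bit x (j + 1) + bit x 0 + a (K + 1) * bit x (K + 1) := by
    rw [Finset.sum_range_succ, Finset.sum_range_succ', ha, one_mul]
  have hmid : ∑ j ∈ Finset.range K, (d * a (j + 2) - a (j + 1)) * bit x (j + 1) =
      d * ∑ j ∈ Finset.range K, a (j + 2) * bit x (j + 1) -
        ∑ j ∈ Finset.range K, a (j + 1) * bit x (j + 1) := by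
    rw [Finset.mul_sum, ← Finset.sum_sub_distrib]
    exact Finset.sum_congr rfl fun j _ => by ring
  have hpush : ∀ b : Bool, collisionWeight d p Q g α θ K (bit (push b x)) =
      d * (bit (push b x) 0 * hornerSum α (K + 1) (bit x)) +
      Q * (g * (bit (push b x) 0 * geomSum p (K + 1) (bit x)) + θ * pairSum α θ K (bit x)) := by
    intro b
    rw [collisionWeight, pairSum_succ_left, ← hp]
    simp only [bit_push_succ]
    ring
  have hhorner : hornerSum α (K + 1) (fun j => bit x (j + 1)) =
      α * hornerSum α (K + 1) (bit x) + bit x (K + 1) - α ^ (K + 1) * bit x 0 := by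
    have h := hornerSum_succ_left α (K + 1) (bit x)
    rw [hornerSum] at h
    linear_combination -h
  have hnow : collisionWeight d p Q g α θ K (bit x) =
      d * (bit x 0 * (α * hornerSum α (K + 1) (bit x) + bit x (K + 1) - α ^ (K + 1) * bit x 0)) +
      Q * ((g - 1) * (bit x 0 * (geomSum p K (fun j => bit x (j + 1)) + p ^ K * bit x (K + 1))) +
        (pairSum α θ K (bit x) + bit x (K + 1) * (θ ^ K * hornerSum α (K + 1) (bit x)))) := by
    rw [collisionWeight, hhorner, geomSum_succ_right, pairSum_succ_right]
  simp only [childMean, birthProb, weight, hlin, hpush, hnow, hlin2, hlin1, hmid, bit_push_true,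
    bit_push_false, geomSum_succ_left]
  have hk : K + 2 - 1 = K + 1 := rfl
  rw [hk]
  generalize hornerSum α (K + 1) (bit x) = f
  generalize geomSum p K (fun j => bit x (j + 1)) = e
  generalize pairSum α θ K (bit x) = v
  generalize bit x (K + 1) = w
  generalize α ^ (K + 1) = A
  generalize p ^ K = P at *
  generalize θ ^ K = T at *
  have hu := bit_eq_zero_or_one x 0
  generalize bit x 0 = u at *
  rw [hα]
  rcases hu with rfl | rfl
  · linear_combination (-p * q) * (w * f * hQ' + Q * v * hθ)
  · linear_combination (-p * q) * (w * (1 - p) * f * hQ' + Q * v * hθ - Q * (e + P * w) * hg)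

/-! ### Criteria for survival and extinction of the history chain -/

lemma hornerSum_nonneg {a : ℝ} (ha : 0 ≤ a) {u : ℕ → ℝ} (hu : ∀ j, 0 ≤ u j) (n : ℕ) :
    0 ≤ hornerSum a n u := by
  induction n with
  | zero => exact le_rfl
  | succ n ih => exact add_nonneg (mul_nonneg ha ih) (hu n)

lemma hornerSum_le {a : ℝ} (ha : 0 ≤ a) (ha1 : a < 1) {u : ℕ → ℝ} (hu : ∀ j, u j ≤ 1) (n : ℕ) :
    hornerSum a n u ≤ 1 / (1 - a) := by
  have h1 : 0 < 1 - a := by linarith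
  induction n with
  | zero => exact (one_div_pos.2 h1).le
  | succ n ih =>
    calc a * hornerSum a n u + u n ≤ a * (1 / (1 - a)) + 1 :=
          add_le_add (mul_le_mul_of_nonneg_left ih ha) (hu n)
      _ = 1 / (1 - a) := by field_simp; ring

lemma geomSum_nonneg {a : ℝ} (ha : 0 ≤ a) {u : ℕ → ℝ} (hu : ∀ j, 0 ≤ u j) (n : ℕ) :
    0 ≤ geomSum a n u :=
  Finset.sum_nonneg fun j _ => mul_nonneg (pow_nonneg ha j) (hu j)

lemma geomSum_le {a : ℝ} (ha : 0 ≤ a) (ha1 : a < 1) (n : ℕ) {u : ℕ → ℝ} (hu : ∀ j, u j ≤ 1) :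
    geomSum a n u ≤ 1 / (1 - a) := by
  have h1 : 0 < 1 - a := by linarith
  induction n generalizing u with
  | zero => simpa [geomSum] using h1.le
  | succ n ih =>
    rw [geomSum_succ_left]
    calc u 0 + a * geomSum a n (fun j => u (j + 1)) ≤ 1 + a * (1 / (1 - a)) :=
          add_le_add (hu 0) (mul_le_mul_of_nonneg_left (ih fun j => hu (j + 1)) ha)
      _ = 1 / (1 - a) := by field_simp; ring

lemma pairSum_nonneg {α θ : ℝ} (hα : 0 ≤ α) (hθ : 0 ≤ θ) {u : ℕ → ℝ} (hu : ∀ j, 0 ≤ u j) (n : ℕ) :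
    0 ≤ pairSum α θ n u :=
  Finset.sum_nonneg fun j _ => mul_nonneg (hu _)
    (mul_nonneg (pow_nonneg hθ j) (hornerSum_nonneg hα hu _))

lemma collisionWeight_nonneg {d p Q g α θ : ℝ} (hd : 0 ≤ d) (hp : 0 ≤ p) (hQ : 0 ≤ Q) (hg : 1 ≤ g)
    (hα : 0 ≤ α) (hθ : 0 ≤ θ) (K : ℕ) {u : ℕ → ℝ} (hu : ∀ j, 0 ≤ u j) :
    0 ≤ collisionWeight d p Q g α θ K u := by
  have h1 := hornerSum_nonneg hα (fun j => hu (j + 1)) (K + 1)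
  have h2 := geomSum_nonneg hp (fun j => hu (j + 1)) (K + 1)
  have h3 := pairSum_nonneg hα hθ hu (K + 1)
  have h4 := hu 0
  have h5 : 0 ≤ g - 1 := by linarith
  unfold collisionWeight
  positivity

/-- The collision weight is dominated by the linear weight with coefficients `θ ^ j`. -/
lemma collisionWeight_le {d p Q g α θ : ℝ} (hp : 0 ≤ p) (hpα : p ≤ α) (hQ : 0 ≤ Q)
    (hg : 1 ≤ g) (hα1 : α < 1) (hdθ : d * θ = 1) (hθ : 0 < θ) (K : ℕ) {u : ℕ → ℝ}
    (hu : ∀ j, 0 ≤ u j) (hu1 : ∀ j, u j ≤ 1) :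
    collisionWeight d p Q g α θ K u ≤
      (d + Q * (g - 1 + d)) / (1 - α) * ∑ j ∈ Finset.range (K + 2), θ ^ j * u j := by
  have hα : 0 ≤ α := hp.trans hpα
  have hd : 0 < d := pos_of_mul_pos_left (by rw [hdθ]; exact one_pos) hθ.le
  have hc : 0 < 1 - α := by linarith
  set S := ∑ j ∈ Finset.range (K + 2), θ ^ j * u j with hS
  have hS' : S = ∑ j ∈ Finset.range (K + 1), θ ^ (j + 1) * u (j + 1) + u 0 := by
    rw [hS, Finset.sum_range_succ', pow_zero, one_mul]
  have htail : 0 ≤ ∑ j ∈ Finset.range (K + 1), θ ^ (j + 1) * u (j + 1) :=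
    Finset.sum_nonneg fun j _ => mul_nonneg (pow_nonneg hθ.le _) (hu _)
  have h0 := hu 0
  have h0S : u 0 ≤ S := by linarith
  have h1 : u 0 * hornerSum α (K + 1) (fun j => u (j + 1)) ≤ S * (1 / (1 - α)) :=
    mul_le_mul h0S (hornerSum_le hα hα1 (fun j => hu1 _) _)
      (hornerSum_nonneg hα (fun j => hu _) _) (h0.trans h0S)
  have hgeom : geomSum p (K + 1) (fun j => u (j + 1)) ≤ 1 / (1 - α) :=
    (geomSum_le hp (hpα.trans_lt hα1) _ (fun j => hu1 _)).trans
      (one_div_le_one_div_of_le hc (by linarith))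
  have h2 : u 0 * geomSum p (K + 1) (fun j => u (j + 1)) ≤ S * (1 / (1 - α)) :=
    mul_le_mul h0S hgeom (geomSum_nonneg hp (fun j => hu _) _) (h0.trans h0S)
  have h3 : pairSum α θ (K + 1) u ≤ d * (S * (1 / (1 - α))) := by
    calc pairSum α θ (K + 1) u
        ≤ ∑ j ∈ Finset.range (K + 1), u (j + 1) * (θ ^ j * (1 / (1 - α))) :=
          Finset.sum_le_sum fun j _ => mul_le_mul_of_nonneg_left
            (mul_le_mul_of_nonneg_left (hornerSum_le hα hα1 hu1 _) (pow_nonneg hθ.le _)) (hu _)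
      _ = d * ((∑ j ∈ Finset.range (K + 1), θ ^ (j + 1) * u (j + 1)) * (1 / (1 - α))) := by
          rw [Finset.sum_mul, Finset.mul_sum]
          refine Finset.sum_congr rfl fun j _ => ?_
          rw [pow_succ]
          linear_combination (-(u (j + 1) * θ ^ j * (1 / (1 - α)))) * hdθ
      _ ≤ d * (S * (1 / (1 - α))) := by
          have : 0 ≤ 1 / (1 - α) := by positivity
          gcongr
          linarith
  have hg1 : 0 ≤ g - 1 := by linarith
  calc collisionWeight d p Q g α θ K u
      ≤ d * (S * (1 / (1 - α))) +
        Q * ((g - 1) * (S * (1 / (1 - α))) + d * (S * (1 / (1 - α)))) := by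
        unfold collisionWeight
        gcongr
    _ = (d + Q * (g - 1 + d)) / (1 - α) * S := by ring

lemma load_succ_succ (K : ℕ) (x : ℕ → Bool) : load (K + 2) x =
    ∑ j ∈ Finset.range K, bit x (j + 1) + bit x 0 + bit x (K + 1) := by
  rw [load, Finset.sum_range_succ, Finset.sum_range_succ']

/-- A linear weight with nonnegative coefficients is at most a multiple of the load. -/
lemma linear_le_load {a : ℕ → ℝ} (n : ℕ) (ha : ∀ j < n, 0 ≤ a j) (x : ℕ → Bool) :
    ∑ j ∈ Finset.range n, a j * bit x j ≤ (∑ j ∈ Finset.range n, a j) * load n x := by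
  rw [load, Finset.mul_sum]
  refine Finset.sum_le_sum fun j hj => mul_le_mul_of_nonneg_right ?_ (bit_nonneg x j)
  exact Finset.single_le_sum (f := a) (fun i hi => ha i (Finset.mem_range.1 hi)) hj

lemma collisionWeight_rootHistory (d p Q g α θ : ℝ) (K : ℕ) :
    collisionWeight d p Q g α θ K (bit rootHistory) = 0 := by
  have hz : (fun j => bit rootHistory (j + 1)) = fun _ => 0 := by
    funext j; simp [bit, rootHistory, push]
  have h1 : ∀ (a : ℝ) (n : ℕ), hornerSum a n (fun _ => 0) = 0 := by
    intro a n
    induction n with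
    | zero => rfl
    | succ n ih => simp [hornerSum, ih]
  rw [collisionWeight, pairSum_succ_left, hz, h1]
  simp [geomSum, pairSum]

lemma weight_rootHistory {a : ℕ → ℝ} (d p q Q g α θ : ℝ) (K : ℕ) (ha : a 0 = 1) :
    weight a d p q Q g α θ K rootHistory = 1 := by
  rw [weight, collisionWeight_rootHistory, Finset.sum_range_succ']
  simp [bit, rootHistory, push, ha]

set_option maxHeartbeats 800000 in
/-- A sufficient condition for the survival of the history chain with `k = K + 2`. The term
`q * p ^ 2 * d * g * Q` is the cost of collisions; `κ` bounds the lower order terms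
`κ * p ^ j * bit x j` of the drift, which are compensated by letting `a j * d ^ j` increase with
`j`, at the total cost `κ / c`. -/
lemma survival_criterion {d K : ℕ} {p q α θ Q g c κ : ℝ} (hd : 1 ≤ d) (hp : 0 ≤ p) (hp1 : p ≤ 1)
    (hq : 0 ≤ q) (hq1 : q ≤ 1) (hα : α = p * d) (hα1 : α < 1) (hc : c = 1 - α)
    (hdθ : (d : ℝ) * θ = 1) (hQ : Q * θ ^ (K + 2) = q) (hg1 : 1 ≤ g)
    (hg : g * (1 - p ^ 2 * d) = 1) (hκ : κ = α * q ^ 2 * Q * g)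
    (hcond : θ ^ (K + 2) * (c + q * (p ^ 2 * d * g * Q + α ^ (K + 2)) + κ / c) < q) :
    ∃ σ > 0, ∀ n, σ ≤ survival d (K + 2) p q n rootHistory := by
  have hd1 : (1 : ℝ) ≤ d := by exact_mod_cast hd
  have hθ0 : 0 < θ := pos_of_mul_pos_right (by rw [hdθ]; exact one_pos) (by linarith)
  have hθ1 : θ ≤ 1 := by nlinarith
  have hα0 : 0 ≤ α := by rw [hα]; positivity
  have hc0 : 0 < c := by linarith
  have hp' : p = α * θ := by rw [hα, mul_assoc, hdθ, mul_one]
  have hQ0 : 0 ≤ Q := nonneg_of_mul_nonneg_left (by rw [hQ]; exact hq) (by positivity)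
  have hκ0 : 0 ≤ κ := by rw [hκ]; positivity
  set R := c + q * (p ^ 2 * d * g * Q + α ^ (K + 2)) with hR
  have hR0 : 0 ≤ R := by positivity
  -- The strict inequality leaves room for a uniform slack `ε` in every coefficient of the drift.
  set ε := (q - θ ^ (K + 2) * (R + κ / c)) / (θ ^ (K + 2) * (K + 1) + θ) with hε
  have hε0 : 0 < ε := div_pos (by linarith) (by positivity)
  have hε' : ε * (θ ^ (K + 2) * (K + 1) + θ) = q - θ ^ (K + 2) * (R + κ / c) := by
    rw [hε]; field_simp
  set a : ℕ → ℝ := fun j => if j = 0 then 1 else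
    θ ^ j * (R + κ * (1 - α ^ j) / c + ε * j) with ha
  have ha0 : a 0 = 1 := by simp [ha]
  have hasucc : ∀ j, a (j + 1) = θ ^ (j + 1) * (R + κ * (1 - α ^ (j + 1)) / c + ε * (j + 1)) := by
    intro j; simp [ha]
  have hpow : ∀ j, α ^ j ≤ 1 := fun j => pow_le_one₀ hα0 hα1.le
  have hann : ∀ j, 0 ≤ a j := by
    intro j
    rcases j with _ | j
    · rw [ha0]; exact zero_le_one
    · rw [hasucc]
      have : 0 ≤ 1 - α ^ (j + 1) := by linarith [hpow (j + 1)]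
      positivity
  have hcoef0 : α + d * a 1 - 1 - p * q * (Q * α * g + d * α ^ (K + 1)) = κ + ε := by
    rw [show a 1 = a (0 + 1) from rfl, hasucc, hR, hα, hc, hα]
    have h1 : 1 - p * d ≠ 0 := by rw [← hα, ← hc]; exact hc0.ne'
    simp only [zero_add, pow_one, Nat.cast_zero]
    rw [mul_div_assoc, div_self h1]
    linear_combination (1 - p * d + q * (p ^ 2 * d * g * Q + (p * d) ^ (K + 2)) + κ + ε) * hdθ
  have hcoefmid : ∀ j, d * a (j + 2) - a (j + 1) = κ * p * p ^ j + ε * θ ^ (j + 1) := by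
    intro j
    rw [hasucc j, show a (j + 2) = a (j + 1 + 1) from rfl, hasucc (j + 1)]
    have e1 : κ * (1 - α ^ (j + 1 + 1)) / c = κ * (1 - α ^ (j + 1)) / c + κ * α ^ (j + 1) := by
      rw [hc]; have : 1 - α ≠ 0 := by linarith
      field_simp; ring
    have e2 : κ * p * p ^ j = θ ^ (j + 1) * (κ * α ^ (j + 1)) := by
      rw [hp', mul_pow]; ring
    rw [e1, e2]
    push_cast
    linear_combination θ ^ (j + 1) * (R + (κ * (1 - α ^ (j + 1)) / c + κ * α ^ (j + 1)) +
      ε * (j + 1 + 1)) * hdθ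
  have hcoeflast : ε ≤ d * q - a (K + 1) := by
    rw [hasucc]
    have h1 : κ * (1 - α ^ (K + 1)) / c ≤ κ / c :=
      div_le_div_of_nonneg_right (mul_le_of_le_one_right hκ0 (by linarith [pow_nonneg hα0 (K + 1)]))
        hc0.le
    have h2 : θ ^ (K + 1) * (R + κ * (1 - α ^ (K + 1)) / c + ε * (K + 1)) ≤
        θ ^ (K + 1) * (R + κ / c + ε * (K + 1)) := by gcongr
    have h3 : d * q - θ ^ (K + 1) * (R + κ / c + ε * (K + 1)) = ε := by
      have : q = θ * (ε + θ ^ (K + 1) * (R + κ / c + ε * (K + 1))) := by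
        rw [pow_succ θ (K + 1)] at hε'; linear_combination -hε'
      rw [this]
      linear_combination (ε + θ ^ (K + 1) * (R + κ / c + ε * (K + 1))) * hdθ
    linarith
  have hθK : θ ^ (K + 1) ≤ 1 := pow_le_one₀ hθ0.le hθ1
  refine survival_bounded_below (h := weight a d p q Q g α θ K) (ε := ε * θ ^ (K + 1))
    (M := ∑ j ∈ Finset.range (K + 2), a j) hd hp hp1 hq hq1 (by positivity) ?_ ?_
    (by rw [weight_rootHistory _ _ _ _ _ _ _ _ ha0]; exact one_pos)
  · intro x
    have h1 := collisionWeight_nonneg (d := d) (by positivity) hp hQ0 hg1 hα0 hθ0.le K (bit_nonneg x)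
    have h2 : 0 ≤ p * q * collisionWeight d p Q g α θ K (bit x) := by positivity
    have h3 := linear_le_load (a := a) (K + 2) (fun j _ => hann j) x
    rw [weight]; linarith
  · intro x
    have hdr := weight_drift (d := d) (K := K) a ha0 hα hdθ hg hQ x
    rw [hcoef0, Finset.sum_congr rfl fun j _ => by rw [hcoefmid j]] at hdr
    have hu := bit_nonneg x 0
    have hw := bit_nonneg x (K + 1)
    have hu1 := bit_le_one x 0
    have hw1 := bit_le_one x (K + 1)
    have hf := hornerSum_nonneg hα0 (bit_nonneg x) (K + 1)
    have he := geomSum_nonneg hp (fun j => bit_nonneg x (j + 1)) K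
    have hsum : ∑ j ∈ Finset.range K, (κ * p * p ^ j + ε * θ ^ (j + 1)) * bit x (j + 1) =
        κ * (p * geomSum p K (fun j => bit x (j + 1))) +
          ∑ j ∈ Finset.range K, ε * θ ^ (j + 1) * bit x (j + 1) := by
      rw [geomSum, Finset.mul_sum, Finset.mul_sum, ← Finset.sum_add_distrib]
      exact Finset.sum_congr rfl fun j _ => by ring
    have hsum2 : ε * θ ^ (K + 1) * ∑ j ∈ Finset.range K, bit x (j + 1) ≤
        ∑ j ∈ Finset.range K, ε * θ ^ (j + 1) * bit x (j + 1) := by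
      rw [Finset.mul_sum]
      refine Finset.sum_le_sum fun j hj => mul_le_mul_of_nonneg_right
        (mul_le_mul_of_nonneg_left ?_ hε0.le) (bit_nonneg _ _)
      exact pow_le_pow_of_le_one hθ0.le hθ1 (by have := Finset.mem_range.1 hj; omega)
    have hlast := mul_le_mul_of_nonneg_right hcoeflast hw
    have hεK : ε * θ ^ (K + 1) ≤ ε := mul_le_of_le_one_right hε0.le hθK
    have hεu := mul_le_mul_of_nonneg_right hεK hu
    have hεw := mul_le_mul_of_nonneg_right hεK hw
    have hgain : 0 ≤ p * q * Q * (p * (bit x 0 * bit x (K + 1)) *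
        (θ ^ K * hornerSum α (K + 1) (bit x)) +
        p ^ 2 * d * g * p ^ K * (bit x 0 * bit x (K + 1))) := by positivity
    have hcoll : (1 - p * bit x 0) * bit x (K + 1) ≤ 1 := by
      have : 0 ≤ p * bit x 0 := by positivity
      exact mul_le_one₀ (by linarith) hw hw1
    have hloss : κ * (((1 - p * bit x 0) * bit x (K + 1)) *
        (bit x 0 + p * geomSum p K (fun j => bit x (j + 1)))) ≤
        κ * (bit x 0 + p * geomSum p K (fun j => bit x (j + 1))) :=
      mul_le_mul_of_nonneg_left (mul_le_of_le_one_left (by positivity) hcoll) hκ0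
    have hκ' : p * q * Q * (d * q * g) = κ := by rw [hκ, hα]; ring
    rw [hsum] at hdr
    rw [load_succ_succ]
    have hκ'' : p * q * Q * (d * q * g * ((1 - p * bit x 0) * bit x (K + 1)) *
          (bit x 0 + p * geomSum p K (fun j => bit x (j + 1)))) =
        κ * (((1 - p * bit x 0) * bit x (K + 1)) *
        (bit x 0 + p * geomSum p K (fun j => bit x (j + 1)))) := by rw [← hκ']; ring
    rw [mul_sub, hκ''] at hdr
    linarith

set_option maxHeartbeats 800000 in
/-- A sufficient condition for the extinction of the history chain with `k = K + 2`. Here the lower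
order terms only involve `bit x 0` and enter through the last term of `R`; `hR0` and `hsmall` keep
the corrected weight positive. -/
lemma extinction_criterion {d K : ℕ} {p q α θ Q g c R : ℝ} (hd : 1 ≤ d) (hp : 0 ≤ p)
    (hq : 0 ≤ q) (hq1 : q ≤ 1) (hα : α = p * d) (hα1 : α < 1) (hc : c = 1 - α)
    (hdθ : (d : ℝ) * θ = 1) (hQ : Q * θ ^ (K + 2) = q) (hg1 : 1 ≤ g)
    (hg : g * (1 - p ^ 2 * d) = 1)
    (hR : R = c + p ^ 2 * d * g * q * Q - p * q * Q * (p * θ ^ K / c + p ^ 2 * d * g * p ^ K))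
    (hR0 : 3 / 4 * c ≤ R) (hsmall : q * (d + Q * (g - 1 + d)) ≤ c ^ 2 / 4)
    (hcond : q < θ ^ (K + 2) * R) :
    Tendsto (fun n => survival d (K + 2) p q n rootHistory) atTop (nhds 0) := by
  have hd1 : (1 : ℝ) ≤ d := by exact_mod_cast hd
  have hθ0 : 0 < θ := pos_of_mul_pos_right (by rw [hdθ]; exact one_pos) (by linarith)
  have hθ1 : θ ≤ 1 := by nlinarith
  have hα0 : 0 ≤ α := by rw [hα]; positivity
  have hpα : p ≤ α := by rw [hα]; exact le_mul_of_one_le_right hp hd1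
  have hp1 : p ≤ 1 := hpα.trans hα1.le
  have hc0 : 0 < c := by linarith
  have hc1 : c ≤ 1 := by linarith
  have hQ0 : 0 ≤ Q := nonneg_of_mul_nonneg_left (by rw [hQ]; exact hq) (by positivity)
  set ε := min (c / (4 * (K + 1))) ((θ ^ (K + 2) * R - q) / (θ ^ (K + 2) * (K + 1) + θ)) with hε
  have hε0 : 0 < ε := lt_min (by positivity) (div_pos (by linarith) (by positivity))
  have hεc : ε * (K + 1) ≤ c / 4 := by
    have := min_le_left (c / (4 * ((K : ℝ) + 1)))
      ((θ ^ (K + 2) * R - q) / (θ ^ (K + 2) * (K + 1) + θ))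
    rw [← hε, le_div_iff₀ (by positivity)] at this
    linarith
  have hε' : ε * (θ ^ (K + 2) * (K + 1) + θ) ≤ θ ^ (K + 2) * R - q := by
    have := min_le_right (c / (4 * ((K : ℝ) + 1)))
      ((θ ^ (K + 2) * R - q) / (θ ^ (K + 2) * (K + 1) + θ))
    rwa [← hε, le_div_iff₀ (by positivity)] at this
  set a : ℕ → ℝ := fun j => if j = 0 then 1 else θ ^ j * (R - ε * j) with ha
  have ha0 : a 0 = 1 := by simp [ha]
  have hasucc : ∀ j, a (j + 1) = θ ^ (j + 1) * (R - ε * (j + 1)) := by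
    intro j; simp [ha]
  have halow : ∀ j < K + 2, c / 2 * θ ^ j ≤ a j := by
    intro j hj
    rcases j with _ | j
    · rw [ha0, pow_zero]; linarith
    · rw [hasucc, mul_comm]
      have h1 : (j : ℝ) + 1 ≤ K + 1 := by
        have : j ≤ K := by omega
        have : (j : ℝ) ≤ K := by exact_mod_cast this
        linarith
      have h2 := mul_le_mul_of_nonneg_left h1 hε0.le
      exact mul_le_mul_of_nonneg_left (by linarith) (by positivity)
  have hann : ∀ j < K + 2, 0 ≤ a j := fun j hj => le_trans (by positivity) (halow j hj)
  have hcoefmid : ∀ j, d * a (j + 2) - a (j + 1) = -(ε * θ ^ (j + 1)) := by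
    intro j
    rw [hasucc j, show a (j + 2) = a (j + 1 + 1) from rfl, hasucc (j + 1)]
    push_cast
    linear_combination θ ^ (j + 1) * (R - ε * (j + 1 + 1)) * hdθ
  have hcoeflast : d * q - a (K + 1) ≤ -ε := by
    have h1 : q ≤ θ * (θ ^ (K + 1) * (R - ε * (K + 1)) - ε) := by
      rw [pow_succ θ (K + 1)] at hε'
      linarith
    have h2 := mul_le_mul_of_nonneg_left h1 (by linarith : (0 : ℝ) ≤ d)
    rw [← mul_assoc, hdθ, one_mul] at h2
    rw [hasucc]
    linarith
  have hθK : θ ^ (K + 1) ≤ 1 := pow_le_one₀ hθ0.le hθ1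
  refine survival_tendsto_zero (h := weight a d p q Q g α θ K) (ε := ε * θ ^ (K + 1))
    (M := ∑ j ∈ Finset.range (K + 2), a j) (m := c / 4 * θ ^ (K + 1)) hp hp1 hq hq1
    (by positivity) (by positivity) ?_ ?_ ?_
  · intro x
    set S := ∑ j ∈ Finset.range (K + 2), θ ^ j * bit x j with hS
    have h1 := collisionWeight_le (d := d) hp hpα hQ0 hg1 hα1 hdθ hθ0 K (bit_nonneg x)
      (bit_le_one x)
    have hS0 : 0 ≤ S := Finset.sum_nonneg fun j _ => mul_nonneg (by positivity) (bit_nonneg _ _)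
    have hSlow : θ ^ (K + 1) * load (K + 2) x ≤ S := by
      rw [load, Finset.mul_sum]
      refine Finset.sum_le_sum fun j hj => mul_le_mul_of_nonneg_right ?_ (bit_nonneg _ _)
      exact pow_le_pow_of_le_one hθ0.le hθ1 (by have := Finset.mem_range.1 hj; omega)
    have hlin : c / 2 * S ≤ ∑ j ∈ Finset.range (K + 2), a j * bit x j := by
      rw [hS, Finset.mul_sum]
      refine Finset.sum_le_sum fun j hj => ?_
      rw [← mul_assoc]
      exact mul_le_mul_of_nonneg_right (halow j (Finset.mem_range.1 hj)) (bit_nonneg _ _)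
    have hG : p * q * collisionWeight d p Q g α θ K (bit x) ≤ c / 4 * S := by
      rw [← hc, ← hS] at h1
      have hg1' : 0 ≤ g - 1 := by linarith
      calc p * q * collisionWeight d p Q g α θ K (bit x)
          ≤ p * q * ((d + Q * (g - 1 + d)) / c * S) :=
            mul_le_mul_of_nonneg_left h1 (by positivity)
        _ ≤ 1 * q * ((d + Q * (g - 1 + d)) / c * S) := by gcongr
        _ = q * (d + Q * (g - 1 + d)) / c * S := by ring
        _ ≤ (c ^ 2 / 4) / c * S := by gcongr
        _ = c / 4 * S := by field_simp
    have h4 := mul_le_mul_of_nonneg_left hSlow (by positivity : 0 ≤ c / 4)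
    rw [weight]; linarith
  · intro x
    have h1 := collisionWeight_nonneg (d := d) (by positivity) hp hQ0 hg1 hα0 hθ0.le K (bit_nonneg x)
    have h2 : 0 ≤ p * q * collisionWeight d p Q g α θ K (bit x) := by positivity
    have h3 := linear_le_load (a := a) (K + 2) hann x
    rw [weight]; linarith
  · intro x
    have hdr := weight_drift (d := d) (K := K) a ha0 hα hdθ hg hQ x
    rw [Finset.sum_congr rfl fun j _ => by rw [hcoefmid j]] at hdr
    have hu := bit_nonneg x 0
    have hw := bit_nonneg x (K + 1)
    have hu1 := bit_le_one x 0
    have hw1 := bit_le_one x (K + 1)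
    have hf := hornerSum_nonneg hα0 (bit_nonneg x) (K + 1)
    have hf1 := hornerSum_le hα0 hα1 (bit_le_one x) (K + 1)
    have he := geomSum_nonneg hp (fun j => bit_nonneg x (j + 1)) K
    have hda1 : d * a 1 = R - ε := by
      rw [show a 1 = a (0 + 1) from rfl, hasucc]
      simp only [zero_add, pow_one, Nat.cast_zero]
      linear_combination (R - ε * 1) * hdθ
    have hsum2 : ∑ j ∈ Finset.range K, -(ε * θ ^ (j + 1)) * bit x (j + 1) ≤
        -(ε * θ ^ (K + 1) * ∑ j ∈ Finset.range K, bit x (j + 1)) := by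
      rw [Finset.mul_sum, ← Finset.sum_neg_distrib]
      refine Finset.sum_le_sum fun j hj => ?_
      rw [neg_mul, neg_le_neg_iff]
      refine mul_le_mul_of_nonneg_right (mul_le_mul_of_nonneg_left ?_ hε0.le) (bit_nonneg _ _)
      exact pow_le_pow_of_le_one hθ0.le hθ1 (by have := Finset.mem_range.1 hj; omega)
    have hlast := mul_le_mul_of_nonneg_right hcoeflast hw
    have hεK : ε * θ ^ (K + 1) ≤ ε := mul_le_of_le_one_right hε0.le hθK
    have hεu := mul_le_mul_of_nonneg_right hεK hu
    have hεw := mul_le_mul_of_nonneg_right hεK hw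
    have huw : bit x 0 * bit x (K + 1) ≤ bit x 0 := mul_le_of_le_one_right hu hw1
    have hgain : p * q * Q * (p * (bit x 0 * bit x (K + 1)) *
        (θ ^ K * hornerSum α (K + 1) (bit x)) +
        p ^ 2 * d * g * p ^ K * (bit x 0 * bit x (K + 1))) ≤
        p * q * Q * (p * bit x 0 * (θ ^ K * (1 / c)) + p ^ 2 * d * g * p ^ K * bit x 0) := by
      rw [← hc] at hf1
      gcongr
    have hloss : 0 ≤ p * q * Q * (d * q * g * ((1 - p * bit x 0) * bit x (K + 1)) *
          (bit x 0 + p * geomSum p K (fun j => bit x (j + 1)))) := by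
      have : 0 ≤ 1 - p * bit x 0 := sub_nonneg.2 (mul_le_one₀ hp1 hu hu1)
      positivity
    have hpos : 0 ≤ p * q * (d * α ^ (K + 1)) * bit x 0 := by positivity
    have hcoef0 : (α + d * a 1 - 1 - p * q * (Q * α * g + d * α ^ (K + 1))) * bit x 0 +
        p * q * Q * (p * bit x 0 * (θ ^ K * (1 / c)) + p ^ 2 * d * g * p ^ K * bit x 0) =
        -(ε * bit x 0) - p * q * (d * α ^ (K + 1)) * bit x 0 := by
      rw [hda1, hR, hα, hc, hα]; ring
    rw [load_succ_succ]
    rw [mul_sub] at hdr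
    linarith

/-! ### Independence of disjoint families of edges -/

section Independence

variable {d k : ℕ} {p q : unitInterval}

instance : IsProbabilityMeasure (law d k p q) := by unfold law; infer_instance

/-- The events that depend only on the edges in `S`. -/
@[reducible] def edgeAlgebra (S : Set (Edge d k)) : MeasurableSpace (Config d k) :=
  ⨆ e ∈ S, MeasurableSpace.comap (fun ω => ω e) ⊤

lemma edgeAlgebra_mono {S T : Set (Edge d k)} (h : S ⊆ T) : edgeAlgebra S ≤ edgeAlgebra T :=
  biSup_mono h

lemma comap_eval_le (e : Edge d k) :
    MeasurableSpace.comap (fun ω : Config d k => ω e) ⊤ ≤ MeasurableSpace.pi :=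
  le_iSup (fun e : Edge d k => MeasurableSpace.comap (fun ω : Config d k => ω e) ⊤) e

lemma edgeAlgebra_le (S : Set (Edge d k)) : edgeAlgebra S ≤ MeasurableSpace.pi :=
  iSup₂_le fun e _ => comap_eval_le e

lemma measurableSet_edge {S : Set (Edge d k)} {e : Edge d k} (he : e ∈ S) (b : Bool) :
    MeasurableSet[edgeAlgebra S] {ω : Config d k | ω e = b} :=
  (le_iSup₂ (f := fun (e : Edge d k) (_ : e ∈ S) =>
    MeasurableSpace.comap (fun ω : Config d k => ω e) ⊤) e he) _ ⟨{b}, trivial, rfl⟩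

lemma indep_edgeAlgebra {S T : Set (Edge d k)} (h : Disjoint S T) :
    ProbabilityTheory.Indep (edgeAlgebra S) (edgeAlgebra T) (law d k p q) := by
  have hind : ProbabilityTheory.iIndepFun (fun (e : Edge d k) (ω : Config d k) => ω e)
      (law d k p q) :=
    ProbabilityTheory.iIndepFun_infinitePi (X := fun _ b => b) (fun _ => measurable_id)
  exact ProbabilityTheory.indep_iSup_of_disjoint comap_eval_le hind h

lemma law_real_inter {S T : Set (Edge d k)} (h : Disjoint S T) {A B : Set (Config d k)}
    (hA : MeasurableSet[edgeAlgebra S] A) (hB : MeasurableSet[edgeAlgebra T] B) :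
    (law d k p q).real (A ∩ B) = (law d k p q).real A * (law d k p q).real B := by
  rw [measureReal_def, (ProbabilityTheory.Indep_iff _ _ _).1 (indep_edgeAlgebra h) A B hA hB,
    ENNReal.toReal_mul]
  rfl

lemma law_real_biInter {ι : Type*} (s : Finset ι) {S : ι → Set (Edge d k)}
    (hS : Pairwise fun i j => Disjoint (S i) (S j)) {A : ι → Set (Config d k)}
    (hA : ∀ i, MeasurableSet[edgeAlgebra (S i)] (A i)) :
    (law d k p q).real (⋂ i ∈ s, A i) = ∏ i ∈ s, (law d k p q).real (A i) := by
  classical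
  induction s using Finset.induction_on with
  | empty => simp
  | insert a s ha ih =>
    rw [Finset.set_biInter_insert, Finset.prod_insert ha, ← ih]
    refine law_real_inter (S := S a) (T := ⋃ i ∈ s, S i) ?_ (hA a) ?_
    · rw [Set.disjoint_iUnion₂_right]
      exact fun i hi => hS (fun h => ha (h ▸ hi))
    · exact s.measurableSet_biInter fun i hi =>
        edgeAlgebra_mono (Set.subset_biUnion_of_mem (u := S) hi) _ (hA i)

lemma law_real_edge (e : Edge d k) :
    (law d k p q).real {ω | ω e = true} = e.openProb p q := by
  have h := Measure.infinitePi_map_eval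
    (μ := fun e : Edge d k => ProbabilityTheory.bernoulliMeasure true false (e.openProb p q)) e
  have h2 : (law d k p q).real ((fun ω : Config d k => ω e) ⁻¹' {true}) =
      (ProbabilityTheory.bernoulliMeasure true false (e.openProb p q)).real {true} := by
    rw [← h, measureReal_def, measureReal_def, Measure.map_apply (measurable_pi_apply e)
      (MeasurableSet.singleton true)]
    rfl
  rw [ProbabilityTheory.bernoulliMeasure_real_apply_of_mem_of_notMem _ _ (by simp) (by simp)] at h2
  · exact h2
  · exact MeasurableSet.singleton true

end Independence

/-! ### Exploring the cluster from a given history -/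

section Exploration

variable {d k : ℕ}

/-- The long edge into `r · i`. It has this target only if `r · i` is at least `k` generations below
the root; otherwise its value is irrelevant. -/
def longInto (k : ℕ) (r : Vertex d) (i : Fin d) : Edge d k :=
  .long ((r ++ [i]).take (r.length + 1 - k)) fun j => (r ++ [i]).getD (r.length + 1 - k + j) i

lemma target_longInto {r : Vertex d} {i : Fin d} (h : k ≤ r.length + 1) :
    (longInto k r i).target = r ++ [i] := by
  have hdrop : List.ofFn (fun j : Fin k => (r ++ [i]).getD (r.length + 1 - k + j) i) =
      (r ++ [i]).drop (r.length + 1 - k) := by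
    apply List.ext_getElem
    · simp; omega
    · intro n h1 h2
      simp only [List.length_ofFn] at h1
      rw [List.getElem_ofFn, List.getElem_drop, List.getD_eq_getElem]
  rw [longInto, Edge.target, hdrop, List.take_append_drop]

/-- Whether the child `r · i` of a vertex `r` with history `x` is in the cluster. -/
def childBit (ω : Config d k) (r : Vertex d) (i : Fin d) (x : ℕ → Bool) : Bool :=
  (x 0 && ω (.short r i)) ||
    (decide (k ≤ r.length + 1) && x (k - 1) && ω (longInto k r i))

/-- If `r` has history `x`, some descendant of `r` at distance `n` has an alive history. -/
def Reaches (ω : Config d k) : ℕ → Vertex d → (ℕ → Bool) → Prop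
  | 0, _, x => Alive k x
  | n + 1, r, x => ∃ i : Fin d, Reaches ω n (r ++ [i]) (push (childBit ω r i x) x)

/-- The edges into `v` or a descendant of `v`. -/
def edgesInto (d k : ℕ) (v : Vertex d) : Set (Edge d k) := {e | ∃ u, e.target = v ++ u}

/-- The edges into proper descendants of `v`. -/
def edgesBelow (d k : ℕ) (v : Vertex d) : Set (Edge d k) := {e | ∃ u, u ≠ [] ∧ e.target = v ++ u}

lemma edgesInto_child_subset (r : Vertex d) (i : Fin d) :
    edgesInto d k (r ++ [i]) ⊆ edgesBelow d k r := by
  rintro e ⟨u, hu⟩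
  exact ⟨i :: u, by simp, by simp [hu]⟩

lemma edgesBelow_subset (v : Vertex d) : edgesBelow d k v ⊆ edgesInto d k v :=
  fun _ ⟨u, _, hu⟩ => ⟨u, hu⟩

lemma edgesInto_child_disjoint (r : Vertex d) :
    Pairwise fun i j : Fin d => Disjoint (edgesInto d k (r ++ [i])) (edgesInto d k (r ++ [j])) := by
  intro i j hij
  rw [Set.disjoint_left]
  rintro e ⟨u, hu⟩ ⟨v, hv⟩
  rw [hu] at hv
  simp at hv
  exact hij hv.1

lemma target_disjoint_edgesBelow (v : Vertex d) :
    Disjoint {e : Edge d k | e.target = v} (edgesBelow d k v) := by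
  rw [Set.disjoint_left]
  rintro e he ⟨u, hu, hu'⟩
  rw [Set.mem_ofPred_eq] at he
  rw [he] at hu'
  simp at hu'
  exact hu hu'

lemma measurableSet_childBit (r : Vertex d) (i : Fin d) (x : ℕ → Bool) :
    MeasurableSet[edgeAlgebra {e : Edge d k | e.target = r ++ [i]}]
      {ω : Config d k | childBit ω r i x = true} := by
  have hs : MeasurableSet[edgeAlgebra {e : Edge d k | e.target = r ++ [i]}]
      {ω : Config d k | ω (.short r i) = true} := measurableSet_edge (by rfl) true
  by_cases hk : k ≤ r.length + 1
  · have hl : MeasurableSet[edgeAlgebra {e : Edge d k | e.target = r ++ [i]}]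
        {ω : Config d k | ω (longInto k r i) = true} := measurableSet_edge (target_longInto hk) true
    cases h0 : x 0 <;> cases h1 : x (k - 1) <;> simp only [childBit, h0, h1, hk, decide_true,
      Bool.true_and, Bool.false_and, Bool.and_false, Bool.or_false, Bool.false_or, Bool.or_eq_true]
    · simp
    · exact hl
    · exact hs
    · exact hs.union hl
  · cases h0 : x 0 <;> simp only [childBit, h0, hk, decide_false,
      Bool.true_and, Bool.false_and, Bool.or_false]
    · simp
    · exact hs

lemma reaches_child_eq (n : ℕ) (r : Vertex d) (i : Fin d) (x : ℕ → Bool) :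
    {ω : Config d k | Reaches ω n (r ++ [i]) (push (childBit ω r i x) x)} =
      ({ω | childBit ω r i x = true} ∩ {ω | Reaches ω n (r ++ [i]) (push true x)}) ∪
      ({ω | childBit ω r i x = true}ᶜ ∩ {ω | Reaches ω n (r ++ [i]) (push false x)}) := by
  ext ω
  cases h : childBit ω r i x <;> simp [h]

lemma measurableSet_reaches (n : ℕ) (r : Vertex d) (x : ℕ → Bool) :
    MeasurableSet[edgeAlgebra (edgesBelow d k r)] {ω : Config d k | Reaches ω n r x} := by
  induction n generalizing r x with
  | zero => simp [Reaches]
  | succ n ih =>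
    have : {ω : Config d k | Reaches ω (n + 1) r x} =
        ⋃ i, {ω | Reaches ω n (r ++ [i]) (push (childBit ω r i x) x)} := by
      ext ω; simp [Reaches]
    rw [this]
    refine MeasurableSet.iUnion fun i => ?_
    rw [reaches_child_eq]
    have hb := edgeAlgebra_mono (fun e (he : e.target = r ++ [i]) =>
      edgesInto_child_subset r i ⟨[], by simp [he]⟩) _ (measurableSet_childBit (k := k) r i x)
    have hsub := edgeAlgebra_mono
      ((edgesBelow_subset (k := k) (r ++ [i])).trans (edgesInto_child_subset r i))
    exact (hb.inter (hsub _ (ih _ _))).union (hb.compl.inter (hsub _ (ih _ _)))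

lemma measurableSet_reaches_child (n : ℕ) (r : Vertex d) (i : Fin d) (x : ℕ → Bool) :
    MeasurableSet[edgeAlgebra (edgesInto d k (r ++ [i]))]
      {ω : Config d k | Reaches ω n (r ++ [i]) (push (childBit ω r i x) x)} := by
  rw [reaches_child_eq]
  have hb := edgeAlgebra_mono (fun e (he : e.target = r ++ [i]) =>
    (⟨[], by simp [he]⟩ : e ∈ edgesInto d k (r ++ [i]))) _ (measurableSet_childBit (k := k) r i x)
  have hsub := edgeAlgebra_mono (edgesBelow_subset (k := k) (r ++ [i]))
  exact (hb.inter (hsub _ (measurableSet_reaches _ _ _))).union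
    (hb.compl.inter (hsub _ (measurableSet_reaches _ _ _)))

variable {p q : unitInterval}

lemma law_real_childBit (r : Vertex d) (i : Fin d) {x : ℕ → Bool}
    (hx : ∀ j, r.length < j → x j = false) (hk : 1 ≤ k) :
    (law d k p q).real {ω | childBit ω r i x = true} = birthProb k p q x := by
  have hs : (law d k p q).real {ω | ω (.short r i) = true} = p := law_real_edge (.short r i)
  by_cases hkr : k ≤ r.length + 1
  · have hl : (law d k p q).real {ω | ω (longInto k r i) = true} = q :=
      law_real_edge (longInto k r i)
    have hsl : (law d k p q).real
        ({ω | ω (.short r i) = true} ∩ {ω | ω (longInto k r i) = true}) = p * q := by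
      rw [law_real_inter (S := {.short r i}) (T := {longInto k r i}) (by simp [longInto])
        (measurableSet_edge (Set.mem_singleton _) true)
        (measurableSet_edge (Set.mem_singleton _) true), hs, hl]
    have hml : MeasurableSet {ω : Config d k | ω (longInto k r i) = true} :=
      edgeAlgebra_le {longInto k r i} _ (measurableSet_edge (Set.mem_singleton _) true)
    have hsl' := measureReal_union_add_inter (μ := law d k p q)
      (s := {ω : Config d k | ω (.short r i) = true}) hml
    rw [hsl, hs, hl] at hsl'
    cases h0 : x 0 <;> cases h1 : x (k - 1) <;> simp only [childBit, h0, h1, hkr, decide_true,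
      Bool.true_and, Bool.false_and, Bool.and_false, Bool.or_false, Bool.false_or, Bool.or_eq_true,
      birthProb, bit, if_true]
    · simp
    · rw [hl]; simp
    · rw [hs]; simp
    · rw [Set.ofPred_or, eq_sub_of_add_eq hsl']; ring
  · have h1 : x (k - 1) = false := hx _ (by omega)
    cases h0 : x 0 <;> simp only [childBit, h0, h1, hkr, decide_false,
      Bool.true_and, Bool.false_and, Bool.or_false, birthProb, bit, if_true]
    · simp
    · rw [hs]; simp

/-- The exploration from a history `x` has the probabilities given by the survival recursion,
provided that `x` claims no ancestors beyond the root. -/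
lemma law_real_reaches (hk : 1 ≤ k) (n : ℕ) (r : Vertex d) {x : ℕ → Bool}
    (hx : ∀ j, r.length < j → x j = false) :
    (law d k p q).real {ω | Reaches ω n r x} = survival d k p q n x := by
  induction n generalizing r x with
  | zero =>
    by_cases h : Alive k x <;> simp [Reaches, survival, h]
  | succ n ih =>
    have hchild : ∀ i : Fin d, (law d k p q).real
        {ω | Reaches ω n (r ++ [i]) (push (childBit ω r i x) x)} =
        childMean k p q (survival d k p q n) x := by
      intro i
      have hpush : ∀ b j, (r ++ [i]).length < j → push b x j = false := by
        intro b j hj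
        rcases j with _ | j
        · omega
        · exact hx j (by simpa using hj)
      have hb := measurableSet_childBit (k := k) r i x
      have hdis := target_disjoint_edgesBelow (k := k) (r ++ [i])
      have hb' := edgeAlgebra_le _ _ hb
      rw [reaches_child_eq, measureReal_union
        (Disjoint.mono Set.inter_subset_left Set.inter_subset_left disjoint_compl_right)
        (hb'.compl.inter (edgeAlgebra_le _ _ (measurableSet_reaches _ _ _))),
        law_real_inter hdis hb (measurableSet_reaches _ _ _),
        law_real_inter hdis hb.compl (measurableSet_reaches _ _ _), ih _ (hpush true),
        ih _ (hpush false), probReal_compl_eq_one_sub hb', law_real_childBit r i hx hk]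
      rfl
    have hset : {ω : Config d k | Reaches ω (n + 1) r x}ᶜ =
        ⋂ i ∈ (Finset.univ : Finset (Fin d)),
          {ω | Reaches ω n (r ++ [i]) (push (childBit ω r i x) x)}ᶜ := by
      ext ω; simp [Reaches]
    have hcompl := probReal_compl_eq_one_sub (μ := law d k p q)
      (edgeAlgebra_le _ _ (measurableSet_reaches (n + 1) r x))
    rw [hset, law_real_biInter _ (edgesInto_child_disjoint r)
      (fun i => (measurableSet_reaches_child n r i x).compl)] at hcompl
    have hprod : ∀ i ∈ (Finset.univ : Finset (Fin d)), (law d k p q).real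
        {ω | Reaches ω n (r ++ [i]) (push (childBit ω r i x) x)}ᶜ =
        1 - childMean k p q (survival d k p q n) x := by
      intro i _
      rw [probReal_compl_eq_one_sub
        (edgeAlgebra_le _ _ (measurableSet_reaches_child n r i x)), hchild]
    rw [Finset.prod_congr rfl hprod, Finset.prod_const, Finset.card_univ, Fintype.card_fin] at hcompl
    simp only [survival]
    linarith

end Exploration

/-! ### The cluster of the root in terms of histories -/

section Cluster

variable {d k : ℕ}

lemma long_eq_longInto {u r : Vertex d} {w : Fin k → Fin d} {i : Fin d}
    (h : u ++ List.ofFn w = r ++ [i]) :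
    k ≤ r.length + 1 ∧ u = (r ++ [i]).take (r.length + 1 - k) ∧
      Edge.long u w = longInto k r i := by
  have hlen : u.length + k = r.length + 1 := by simpa using congrArg List.length h
  have hu : r.length + 1 - k = u.length := by omega
  refine ⟨by omega, by rw [← h, hu, List.take_left], ?_⟩
  rw [longInto, ← h, hu, List.take_left]
  congr 1
  funext j
  rw [List.getD_eq_getElem _ _ (by simp)]
  simp

open Classical in
/-- The history of the vertex `v` in the configuration `ω`. -/
noncomputable def history (ω : Config d k) (v : Vertex d) : ℕ → Bool :=
  fun j => decide (j ≤ v.length ∧ v.take (v.length - j) ∈ cluster ω)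

lemma history_eq_true {ω : Config d k} {v : Vertex d} {j : ℕ} :
    history ω v j = true ↔ j ≤ v.length ∧ v.take (v.length - j) ∈ cluster ω := by
  simp [history]

lemma nil_mem_cluster (ω : Config d k) : [] ∈ cluster ω := Relation.ReflTransGen.refl

/-- A vertex other than the root has one short and at most one long edge into it, so whether it is in
the cluster is decided by the history of its parent and these two edges. -/
lemma mem_cluster_append_singleton (hk : 1 ≤ k) (ω : Config d k) (r : Vertex d) (i : Fin d) :
    r ++ [i] ∈ cluster ω ↔ childBit ω r i (history ω r) = true := by
  have htake : ∀ m ≤ r.length, (r ++ [i]).take m = r.take m := fun m hm =>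
    List.take_append_of_le_length hm
  simp only [childBit, Bool.or_eq_true, Bool.and_eq_true, decide_eq_true_eq, history_eq_true]
  constructor
  · intro h
    rcases Relation.ReflTransGen.cases_tail h with h0 | ⟨u, hu, e, he, hsrc, htgt⟩
    · simp at h0
    · cases e with
      | short s j =>
        obtain ⟨rfl, hj⟩ := List.append_inj' htgt rfl
        obtain rfl : j = i := by simpa using hj
        obtain rfl : s = u := hsrc
        exact Or.inl ⟨⟨Nat.zero_le _, by rw [Nat.sub_zero, List.take_length]; exact hu⟩, he⟩
      | long s w =>
        obtain rfl : s = u := hsrc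
        obtain ⟨hkr, hs, hl⟩ := long_eq_longInto htgt
        refine Or.inr ⟨⟨hkr, by omega, ?_⟩, by rw [← hl]; exact he⟩
        rw [htake _ (by omega)] at hs
        rw [show r.length - (k - 1) = r.length + 1 - k by omega, ← hs]
        exact hu
  · rintro (⟨⟨-, hr⟩, he⟩ | ⟨⟨hkr, -, hr⟩, he⟩)
    · rw [Nat.sub_zero, List.take_length] at hr
      exact Relation.ReflTransGen.tail hr ⟨_, he, rfl, rfl⟩
    · refine Relation.ReflTransGen.tail hr ⟨_, he, ?_, target_longInto hkr⟩
      rw [longInto, Edge.source, htake _ (by omega)]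
      congr 1
      omega

lemma history_append_singleton (hk : 1 ≤ k) (ω : Config d k) (r : Vertex d) (i : Fin d) :
    history ω (r ++ [i]) = push (childBit ω r i (history ω r)) (history ω r) := by
  funext j
  rw [Bool.eq_iff_iff]
  rcases j with _ | j
  · rw [history_eq_true, push, ← mem_cluster_append_singleton hk, Nat.sub_zero,
      List.take_length]
    simp
  · rw [history_eq_true, push, history_eq_true]
    have h1 : (r ++ [i]).length - (j + 1) = r.length - j := by simp
    rw [h1, List.take_append_of_le_length (Nat.sub_le _ _)]
    simp

lemma history_nil (ω : Config d k) : history ω [] = rootHistory := by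
  funext j
  rw [Bool.eq_iff_iff, history_eq_true]
  rcases j with _ | j
  · simp [rootHistory, push, nil_mem_cluster]
  · simp [rootHistory, push]

lemma reaches_history_iff (hk : 1 ≤ k) (ω : Config d k) (n : ℕ) (r : Vertex d) :
    Reaches ω n r (history ω r) ↔ ∃ u : Vertex d, u.length = n ∧ Alive k (history ω (r ++ u)) := by
  induction n generalizing r with
  | zero => simp [Reaches]
  | succ n ih =>
    simp only [Reaches, ← history_append_singleton hk, ih]
    constructor
    · rintro ⟨i, u, hu, h⟩
      exact ⟨i :: u, by simp [hu], by simpa using h⟩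
    · rintro ⟨u, hu, h⟩
      obtain ⟨i, v, rfl⟩ := List.exists_cons_of_length_eq_add_one hu
      exact ⟨i, v, by simpa using hu, by simpa using h⟩

lemma reaches_root_iff (hk : 1 ≤ k) (ω : Config d k) (n : ℕ) :
    Reaches ω n [] rootHistory ↔ ∃ u : Vertex d, u.length = n ∧ Alive k (history ω u) := by
  rw [← history_nil ω, reaches_history_iff hk]
  simp

lemma alive_of_alive_child (hk : 1 ≤ k) {ω : Config d k} {r : Vertex d} {i : Fin d}
    (h : Alive k (history ω (r ++ [i]))) : Alive k (history ω r) := by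
  obtain ⟨j, hj, hx⟩ := h
  rw [history_append_singleton hk] at hx
  rcases j with _ | j
  · simp only [push, childBit, Bool.or_eq_true, Bool.and_eq_true] at hx
    rcases hx with hx | hx
    · exact ⟨0, hj, hx.1⟩
    · exact ⟨k - 1, by omega, hx.1.2⟩
  · exact ⟨j, by omega, hx⟩

lemma reaches_root_antitone (hk : 1 ≤ k) :
    Antitone fun n => {ω : Config d k | Reaches ω n [] rootHistory} := by
  refine antitone_nat_of_succ_le fun n ω hω => ?_
  obtain ⟨u, hu, h⟩ := (reaches_root_iff hk ω (n + 1)).1 hω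
  obtain ⟨v, i, rfl⟩ : ∃ v i, u = v ++ [i] := by
    rcases List.eq_nil_or_concat u with rfl | ⟨v, i, rfl⟩
    · simp at hu
    · exact ⟨v, i, by simp⟩
  exact (reaches_root_iff hk ω n).2 ⟨v, by simpa using hu, alive_of_alive_child hk h⟩

lemma target_eq (e : Edge d k) : ∃ w : Vertex d, e.target = e.source ++ w ∧ w.length ≤ max 1 k := by
  cases e with
  | short r i => exact ⟨[i], rfl, by simp⟩
  | long r w => exact ⟨List.ofFn w, rfl, by simp⟩

/-- A path to depth at least `n` visits one of the `k` generations up to `n`, since an edge spans at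
most `k` generations. -/
lemma exists_alive_of_mem_cluster (hk : 1 ≤ k) {ω : Config d k} (n : ℕ) {v : Vertex d}
    (hv : v ∈ cluster ω) (hn : n ≤ v.length) :
    ∃ u : Vertex d, u.length = n ∧ Alive k (history ω u) := by
  have hself : ∀ u : Vertex d, u ∈ cluster ω → Alive k (history ω u) := fun u hu =>
    ⟨0, hk, history_eq_true.2 ⟨Nat.zero_le _, by simpa using hu⟩⟩
  induction hv with
  | refl => exact ⟨[], (Nat.le_zero.1 hn).symm, hself _ (nil_mem_cluster ω)⟩
  | @tail u v hu hstep ih =>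
    rcases le_or_gt n u.length with h | h
    · exact ih h
    rcases hn.eq_or_lt with h' | h'
    · exact ⟨v, h'.symm, hself v (Relation.ReflTransGen.tail hu hstep)⟩
    obtain ⟨e, -, rfl, rfl⟩ := hstep
    obtain ⟨w, hw, hlen⟩ := target_eq e
    rw [hw, List.length_append] at h'
    have htl : (e.target.take n).length = n := by
      rw [List.length_take, hw, List.length_append]; omega
    refine ⟨e.target.take n, htl, n - e.source.length, by omega, history_eq_true.2 ⟨by omega, ?_⟩⟩
    rw [htl, List.take_take, show min (n - (n - e.source.length)) n = e.source.length by omega,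
      hw, List.take_left]
    exact hu

/-- The cluster of the root is infinite iff every generation has a vertex with alive history. -/
lemma cluster_infinite_iff (hk : 1 ≤ k) (ω : Config d k) :
    (cluster ω).Infinite ↔ ∀ n, Reaches ω n [] rootHistory := by
  constructor
  · intro h n
    have hfin : {v : Vertex d | v.length < n}.Finite := List.finite_length_lt (Fin d) n
    obtain ⟨v, hv, hvn⟩ := h.exists_notMem_finite hfin
    exact (reaches_root_iff hk ω n).2
      (exists_alive_of_mem_cluster hk n hv (not_lt.1 hvn))
  · intro h hfin
    obtain ⟨N, hN⟩ := (hfin.image List.length).bddAbove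
    obtain ⟨v, hv, j, hj, hx⟩ := (reaches_root_iff hk ω (N + k)).1 (h (N + k))
    obtain ⟨-, hmem⟩ := history_eq_true.1 hx
    have := hN ⟨_, hmem, rfl⟩
    rw [List.length_take] at this
    omega

variable {p q : unitInterval}

lemma law_real_reaches_root (hk : 1 ≤ k) (n : ℕ) :
    (law d k p q).real {ω | Reaches ω n [] rootHistory} = survival d k p q n rootHistory := by
  refine law_real_reaches hk n [] fun j hj => ?_
  rcases j with _ | j
  · simp at hj
  · rfl

lemma law_infinite_pos (hk : 1 ≤ k) (h : ∃ σ > 0, ∀ n, σ ≤ survival d k p q n rootHistory) :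
    0 < law d k p q {ω | (cluster ω).Infinite} := by
  obtain ⟨σ, hσ, h⟩ := h
  have hset : {ω : Config d k | (cluster ω).Infinite} =
      ⋂ n, {ω | Reaches ω n [] rootHistory} := by
    ext ω; simp [cluster_infinite_iff hk]
  have hlim := tendsto_measure_iInter_atTop (μ := law d k p q)
    (fun n => (edgeAlgebra_le _ _ (measurableSet_reaches (k := k) n [] rootHistory)).nullMeasurableSet)
    (reaches_root_antitone hk) ⟨0, measure_ne_top _ _⟩
  rw [← hset] at hlim
  refine (ENNReal.ofReal_pos.2 hσ).trans_le (ge_of_tendsto' hlim fun n => ?_)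
  rw [Function.comp_apply, ENNReal.ofReal_le_iff_le_toReal (measure_ne_top _ _)]
  exact (h n).trans_eq (law_real_reaches_root hk n).symm

lemma law_infinite_eq_zero (hk : 1 ≤ k)
    (h : Tendsto (fun n => survival d k p q n rootHistory) atTop (nhds 0)) :
    law d k p q {ω | (cluster ω).Infinite} = 0 := by
  have hle : ∀ n, (law d k p q).real {ω | (cluster ω).Infinite} ≤
      survival d k p q n rootHistory := by
    intro n
    rw [← law_real_reaches_root hk n]
    exact measureReal_mono fun ω hω => (cluster_infinite_iff hk ω).1 hω n
  have := ge_of_tendsto' h hle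
  exact (measureReal_eq_zero_iff).1 (le_antisymm this measureReal_nonneg)

end Cluster

/-! ### The asymptotics of the two criteria -/

section Asymptotic

variable {d : ℕ} {p α θ γ g c : ℝ}

/-- At `q = t (c + b t)` with `t = θ ^ k` and `b` above the claimed second coefficient, the
criterion for survival holds eventually. -/
lemma eventually_survival (hd : 2 ≤ d) (hp : 0 ≤ p) (hα : α = p * d) (hα1 : α < 1)
    (hc : c = 1 - α) (hθ : θ = 1 / d) (hg1 : 1 ≤ g) (hg : g * (1 - p ^ 2 * d) = 1) {b : ℝ}
    (hb : c ^ 2 * (p ^ 2 * d) * g < b) :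
    ∀ᶠ K : ℕ in atTop, ∀ q : ℝ, q = θ ^ (K + 2) * (c + b * θ ^ (K + 2)) →
      q ∈ Set.Icc (0 : ℝ) 1 ∧ ∃ σ > 0, ∀ n, σ ≤ survival d (K + 2) p q n rootHistory := by
  have hd2 : (2 : ℝ) ≤ d := by exact_mod_cast hd
  have hdθ : (d : ℝ) * θ = 1 := by rw [hθ]; field_simp
  have hθ0 : 0 < θ := by rw [hθ]; positivity
  have hθ1 : θ < 1 := by nlinarith
  have hα0 : 0 ≤ α := by rw [hα]; positivity
  have hc0 : 0 < c := by linarith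
  have hpα : p ≤ α := by rw [hα]; exact le_mul_of_one_le_right hp (by linarith)
  have hb0 : 0 < b := lt_of_le_of_lt (by positivity) hb
  have ht : Tendsto (fun K : ℕ => θ ^ (K + 2)) atTop (nhds 0) :=
    (tendsto_add_atTop_iff_nat 2).2 (tendsto_pow_atTop_nhds_zero_of_lt_one hθ0.le hθ1)
  have hαt : Tendsto (fun K : ℕ => α ^ (K + 2)) atTop (nhds 0) :=
    (tendsto_add_atTop_iff_nat 2).2 (tendsto_pow_atTop_nhds_zero_of_lt_one hα0 hα1)
  have hz : Tendsto (fun K : ℕ => c + b * θ ^ (K + 2)) atTop (nhds c) := by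
    simpa using (ht.const_mul b).const_add c
  have hq : Tendsto (fun K : ℕ => θ ^ (K + 2) * (c + b * θ ^ (K + 2))) atTop (nhds 0) := by
    simpa using ht.mul hz
  have hmain : Tendsto (fun K : ℕ => (c + b * θ ^ (K + 2)) *
      (p ^ 2 * d * g * (c + b * θ ^ (K + 2)) + α ^ (K + 2)) +
      α * θ ^ (K + 2) * (c + b * θ ^ (K + 2)) ^ 3 * g / c) atTop
      (nhds (c ^ 2 * (p ^ 2 * d) * g)) := by
    have := (hz.mul ((hz.const_mul (p ^ 2 * d * g)).add hαt)).add
      ((((ht.const_mul α).mul (hz.pow 3)).mul_const g).div_const c)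
    convert this using 2
    ring
  filter_upwards [hmain.eventually_lt_const hb, hq.eventually_lt_const one_pos] with K h1 h2
  rintro q rfl
  set t := θ ^ (K + 2) with htdef
  have ht0 : 0 < t := by positivity
  have hz0 : 0 < c + b * t := by positivity
  refine ⟨⟨by positivity, h2.le⟩, ?_⟩
  refine survival_criterion (Q := c + b * t) (by omega) hp (hpα.trans hα1.le) (by positivity) h2.le
    hα hα1 hc hdθ (mul_comm _ _) hg1 hg rfl ?_
  rw [← htdef]
  refine mul_lt_mul_of_pos_left ?_ ht0
  have h3 := mul_lt_mul_of_pos_left h1 ht0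
  calc _ = c + t * ((c + b * t) * (p ^ 2 * d * g * (c + b * t) + α ^ (K + 2)) +
        α * t * (c + b * t) ^ 3 * g / c) := by ring
    _ < c + t * b := by linarith
    _ = c + b * t := by ring

/-- For all `q ≤ t (c + b t)` with `t = θ ^ k` and `b` below the claimed second coefficient, the
criterion for extinction holds eventually. -/
lemma eventually_extinction (hd : 2 ≤ d) (hp : 0 ≤ p) (hα : α = p * d) (hα1 : α < 1)
    (hc : c = 1 - α) (hθ : θ = 1 / d) (hg1 : 1 ≤ g) (hg : g * (1 - p ^ 2 * d) = 1) {b : ℝ}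
    (hb : b < c ^ 2 * (p ^ 2 * d) * g) :
    ∀ᶠ K : ℕ in atTop, ∀ q : ℝ, 0 ≤ q → q ≤ 1 → q ≤ θ ^ (K + 2) * (c + b * θ ^ (K + 2)) →
      Tendsto (fun n => survival d (K + 2) p q n rootHistory) atTop (nhds 0) := by
  have hd2 : (2 : ℝ) ≤ d := by exact_mod_cast hd
  have hdθ : (d : ℝ) * θ = 1 := by rw [hθ]; field_simp
  have hθ0 : 0 < θ := by rw [hθ]; positivity
  have hθ1 : θ < 1 := by nlinarith
  have hc0 : 0 < c := by linarith
  have hpα : p ≤ α := by rw [hα]; exact le_mul_of_one_le_right hp (by linarith)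
  have hp1 : p < 1 := hpα.trans_lt hα1
  have ht : Tendsto (fun K : ℕ => θ ^ (K + 2)) atTop (nhds 0) :=
    (tendsto_add_atTop_iff_nat 2).2 (tendsto_pow_atTop_nhds_zero_of_lt_one hθ0.le hθ1)
  have hz : Tendsto (fun K : ℕ => c + b * θ ^ (K + 2)) atTop (nhds c) := by
    simpa using (ht.const_mul b).const_add c
  have he : Tendsto (fun K : ℕ => p * θ ^ K / c + p ^ 2 * d * g * p ^ K) atTop (nhds 0) := by
    have h1 := tendsto_pow_atTop_nhds_zero_of_lt_one hθ0.le hθ1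
    have h2 := tendsto_pow_atTop_nhds_zero_of_lt_one hp hp1
    simpa using ((h1.const_mul p).div_const c).add (h2.const_mul (p ^ 2 * d * g))
  have hco : Tendsto (fun K : ℕ => p ^ 2 * d * g -
      p * (p * θ ^ K / c + p ^ 2 * d * g * p ^ K)) atTop (nhds (p ^ 2 * d * g)) := by
    simpa using (he.const_mul p).const_sub (p ^ 2 * d * g)
  have h1 : ∀ᶠ K : ℕ in atTop, b < (p ^ 2 * d * g -
      p * (p * θ ^ K / c + p ^ 2 * d * g * p ^ K)) * (c + b * θ ^ (K + 2)) ^ 2 := by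
    refine (hco.mul (hz.pow 2)).eventually_const_lt ?_
    linarith
  have h2 : ∀ᶠ K : ℕ in atTop, θ ^ (K + 2) * (p ^ 2 * d * g -
      p * (p * θ ^ K / c + p ^ 2 * d * g * p ^ K)) * (2 * (c + b * θ ^ (K + 2))) < 1 :=
    ((ht.mul hco).mul (hz.const_mul 2)).eventually_lt_const (by simp)
  have h3 : ∀ᶠ K : ℕ in atTop, p * θ ^ (K + 2) * (c + b * θ ^ (K + 2)) ^ 2 *
      (p * θ ^ K / c + p ^ 2 * d * g * p ^ K) < c / 4 :=
    (((ht.const_mul p).mul (hz.pow 2)).mul he).eventually_lt_const (by simpa using hc0)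
  have h4 : ∀ᶠ K : ℕ in atTop, θ ^ (K + 2) * (c + b * θ ^ (K + 2)) *
      (d + (c + b * θ ^ (K + 2)) * (g - 1 + d)) < c ^ 2 / 4 :=
    ((ht.mul hz).mul ((hz.mul_const (g - 1 + d)).const_add (d : ℝ))).eventually_lt_const
      (by simpa using pow_pos hc0 2)
  filter_upwards [h1, h2, h3, h4] with K h1 h2 h3 h4 q hq0 hq1 hq
  have hg1' : 0 ≤ g - 1 := by linarith
  set t := θ ^ (K + 2) with htdef
  set e := p * θ ^ K / c + p ^ 2 * d * g * p ^ K with hedef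
  set w := p ^ 2 * d * g - p * e with hwdef
  set Z := c + b * t with hZ
  have ht0 : 0 < t := by positivity
  have he0 : 0 ≤ e := by positivity
  obtain ⟨z, hz⟩ : ∃ z, z = q / t := ⟨_, rfl⟩
  have hqz : z * t = q := by rw [hz]; field_simp
  have hz0 : 0 ≤ z := by rw [hz]; positivity
  have hzZ : z ≤ Z := le_of_mul_le_mul_left (by rw [mul_comm, hqz]; exact hq) ht0
  have hZ0 : 0 ≤ Z := hz0.trans hzZ
  have hzsq : z ^ 2 ≤ Z ^ 2 := pow_le_pow_left₀ hz0 hzZ 2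
  refine extinction_criterion (Q := z) (R := c + p ^ 2 * d * g * q * z - p * q * z * e)
    (by omega) hp hq0 hq1 hα hα1 hc hdθ hqz hg1 hg rfl ?_ ?_ ?_
  · have h5 : p * q * z * e ≤ p * t * Z ^ 2 * e := by
      rw [← hqz]
      calc p * (z * t) * z * e = p * t * z ^ 2 * e := by ring
        _ ≤ p * t * Z ^ 2 * e := by gcongr
    have h6 : 0 ≤ p ^ 2 * d * g * q * z := by positivity
    linarith
  · rw [← hqz]
    calc z * t * (d + z * (g - 1 + d)) ≤ Z * t * (d + Z * (g - 1 + d)) := by gcongr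
      _ = t * Z * (d + Z * (g - 1 + d)) := by ring
      _ ≤ c ^ 2 / 4 := h4.le
  · rw [← htdef, ← hqz, mul_comm z t]
    refine mul_lt_mul_of_pos_left ?_ ht0
    -- `z - t w z ^ 2` increases in `z` up to `Z`, so it suffices to compare with `c` at `Z`.
    have hslope : t * w * (z + Z) ≤ 1 := by
      rcases le_or_gt (t * w) 0 with h | h
      · exact (mul_nonpos_of_nonpos_of_nonneg h (by linarith)).trans zero_le_one
      · exact (mul_le_mul_of_nonneg_left (by linarith) h.le).trans h2.le
    have hmono := mul_nonneg (sub_nonneg.2 hzZ) (sub_nonneg.2 hslope)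
    have hend := mul_lt_mul_of_pos_left h1 ht0
    have hgoal : p ^ 2 * d * g * (t * z) * z - p * (t * z) * z * e = t * w * z ^ 2 := by
      rw [hwdef]; ring
    have hZ' : Z = c + b * t := rfl
    nlinarith

end Asymptotic

end TreePercolation

open TreePercolation in
theorem theorem2 (d : ℕ) (hd : 2 ≤ d) (p : unitInterval) (hpd : (p : ℝ) * (d : ℝ) < 1) :
    (fun k : ℕ => TreePercolation.qc d k p -
        ((1 - (p : ℝ) * d) * (1 / (d : ℝ) ^ k) +
          (1 - (p : ℝ) * d) ^ 2 * (p : ℝ) ^ 2 * d / (1 - (p : ℝ) ^ 2 * d) *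
            (1 / (d : ℝ) ^ (2 * k))))
      =o[atTop] (fun k : ℕ => 1 / (d : ℝ) ^ (2 * k)) := by
  have hp0 : (0 : ℝ) ≤ p := p.2.1
  have hp1 : (p : ℝ) ≤ 1 := p.2.2
  have hγ : (p : ℝ) ^ 2 * d < 1 := by
    have : (p : ℝ) * (p * d) ≤ p * d := mul_le_of_le_one_left (by positivity) hp1
    linarith
  have hγ0 : 0 ≤ (p : ℝ) ^ 2 * d := by positivity
  have hγ1 : 0 < 1 - (p : ℝ) ^ 2 * d := by linarith
  obtain ⟨g, hgdef⟩ : ∃ g : ℝ, g = 1 / (1 - (p : ℝ) ^ 2 * d) := ⟨_, rfl⟩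
  have hg : g * (1 - (p : ℝ) ^ 2 * d) = 1 := by rw [hgdef]; field_simp
  have hg1 : 1 ≤ g := by rw [hgdef, le_div_iff₀ hγ1]; linarith
  set B : ℝ := (1 - (p : ℝ) * d) ^ 2 * ((p : ℝ) ^ 2 * d) * g with hB
  rw [isLittleO_iff]
  intro δ hδ
  have hup := eventually_survival hd hp0 rfl hpd rfl rfl hg1 hg (b := B + δ) (by linarith)
  have hlow := eventually_extinction hd hp0 rfl hpd rfl rfl hg1 hg (b := B - δ) (by linarith)
  have hboth := hup.and hlow
  rw [eventually_atTop] at hboth ⊢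
  obtain ⟨N, hN⟩ := hboth
  refine ⟨N + 2, fun k hk => ?_⟩
  obtain ⟨K, rfl⟩ : ∃ K, k = K + 2 := ⟨k - 2, by omega⟩
  obtain ⟨h1, h2⟩ := hN K (by omega)
  obtain ⟨t, ht⟩ : ∃ t : ℝ, t = (1 / (d : ℝ)) ^ (K + 2) := ⟨_, rfl⟩
  rw [← ht] at h1 h2
  have e1 : 1 / (d : ℝ) ^ (K + 2) = t := by rw [ht, one_div_pow]
  have e2 : 1 / (d : ℝ) ^ (2 * (K + 2)) = t ^ 2 := by
    rw [ht, ← pow_mul, one_div_pow, mul_comm]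
  have e3 : (1 - (p : ℝ) * d) ^ 2 * (p : ℝ) ^ 2 * d / (1 - (p : ℝ) ^ 2 * d) = B := by
    rw [hB, hgdef]; ring
  rw [e1, e2, e3, Real.norm_of_nonneg (sq_nonneg t), Real.norm_eq_abs, abs_le]
  obtain ⟨hmem, hsurv⟩ := h1 _ rfl
  have hpos := law_infinite_pos (p := p) (q := ⟨_, hmem⟩) (by omega) hsurv
  have hin : t * (1 - (p : ℝ) * d + (B + δ) * t) ∈ {x : ℝ | ∃ q : unitInterval, (q : ℝ) = x ∧
      0 < law d (K + 2) p q {ω | (cluster ω).Infinite}} := ⟨⟨_, hmem⟩, rfl, hpos⟩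
  have hub : qc d (K + 2) p ≤ t * (1 - (p : ℝ) * d + (B + δ) * t) :=
    csInf_le ⟨0, by rintro x ⟨q, rfl, -⟩; exact q.2.1⟩ hin
  have hlb : t * (1 - (p : ℝ) * d + (B - δ) * t) ≤ qc d (K + 2) p := by
    refine le_csInf ⟨_, hin⟩ ?_
    rintro x ⟨q, rfl, hq⟩
    by_contra hlt
    exact hq.ne' (law_infinite_eq_zero (by omega) (h2 q q.2.1 q.2.2 (not_le.1 hlt).le))
  constructor <;> linarith
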